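/- Let $r\ge 1$. Let $\mathcal C$ be the Hankel contour: it runs along the top side of the real axis from $+\infty$ to $\epsilon$, once counterclockwise around the circle $|x|=\epsilon$, and back along the bottom side of the real axis from $\epsilon$ to $+\infty$, where $\epsilon>0$ is small in the sense that $r\epsilon<1$; on $\mathcal C$ the powers $x^{s-1}$ are taken with $\arg x$ running continuously from $0$ to $2\pi$. Write $y_j:=x_j+x_{j+1}+\cdots+x_r$ for $1\le j\le r$, and $$C(s_1,\dots,s_r):=\prod_{k=1}^r\frac{1}{(e^{2\pi i s_k}-1)\,\Gamma(s_k)} .$$ For $0<t<1$ and $s_1,\dots,s_r\in\mathbb C\setminus\mathbb Z$ put $$\hat\zeta^{\rm des}_r(s_1,\dots,s_r)(t):=C(s_1,\dots,s_r)\int_{\mathcal C^r}\prod_{j=1}^r\left(\frac{1}{\frac1t e^{y_j}-1}+\frac{(\log t-y_j)\,\frac1t e^{y_j}}{\left(\frac1t e^{y_j}-1\right)^2}\right)\prod_{k=1}^r x_k^{s_k-1}\,dx_k .$$ For $s_1,\dots,s_r\in\mathbb C\setminus\mathbb Z$, the desingularized multiple zeta function is $$\zeta^{\rm des}_r(s_1,\dots,s_r):=\lim_{\substack{c\to1\\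 c\in\mathbb R,\ c\neq1}}\frac{1}{(1-c)^r}\,C(s_1,\dots,s_r)\int_{\mathcal C^r}\prod_{j=1}^r\left(\frac{1}{e^{y_j}-1}-\frac{c}{e^{c y_j}-1}\right)\prod_{k=1}^r x_k^{s_k-1}\,dx_k .$$ (The removable singularities of the integrands at $y_j=\log t$, respectively $y_j=0$, are filled by the limit values $-\frac12$, respectively $\frac{c-1}{2}$.) **Proposition.** 1. For every $t\in(0,1)$, the integral defining $\hat\zeta^{\rm des}_r(s_1,\dots,s_r)(t)$ converges absolutely for all $s_1,\dots,s_r\in\mathbb C\setminus\mathbb Z$ and all $\epsilon>0$ with $r\epsilon<1$, its value does not depend on $\epsilon$, and $\hat\zeta^{\rm des}_r(s_1,\dots,s_r)(t)$ continues analytically to an entire function of $(s_1,\dots,s_r)\in\mathbb C^r$. 2. Likewise, for all $s_1,\dots,s_r\in\mathbb C\setminus\mathbb Z$ and all $\epsilon>0$ with $r\epsilon<1$, the integrals in the definition of $\zeta^{\rm des}_r(s_1,\dots,s_r)$ converge absolutely for $c$ near $1$, $c\ne 1$, the limit exists and does not depend on $\epsilon$, and $\zeta^{\rm des}_r$ continues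 analytically to an entire function on $\mathbb C^r$. 3. For the functions so continued, and for every $(s_1,\dots,s_r)\in\mathbb C^r$, $$\lim_{t\to1-0}\hat\zeta^{\rm des}_r(s_1,\dots,s_r)(t)=\zeta^{\rm des}_r(s_1,\dots,s_r).$$ -/

import Mathlib

namespace DesMZF

/-- Modulus of the point with parameter `u` on the Hankel contour of radius `ε`: the parameter
range `u ≤ 0` is the top side of `[ε, ∞)` (run from `+∞` to `ε`), `0 ≤ u ≤ 2π` is the circle
(run counterclockwise), and `2π ≤ u` is the bottom side of `[ε, ∞)` (run from `ε` to `+∞`). -/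
noncomputable def hankelRadius (ε u : ℝ) : ℝ :=
  if u < 0 then ε - u else if u ≤ 2 * Real.pi then ε else ε + (u - 2 * Real.pi)

/-- Argument along the Hankel contour: `0` on the top side, increasing from `0` to `2π` on the
circle, `2π` on the bottom side. -/
noncomputable def hankelArg (u : ℝ) : ℝ :=
  if u < 0 then 0 else if u ≤ 2 * Real.pi then u else 2 * Real.pi

/-- The parametrised Hankel contour. -/
noncomputable def hankelPoint (ε u : ℝ) : ℂ :=
  (hankelRadius ε u : ℂ) * Complex.exp (Complex.I * (hankelArg u : ℂ))

/-- Derivative in `u` of `hankelPoint ε u` (away from the two corners `u = 0` and `u = 2π`). -/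
noncomputable def hankelVelocity (ε u : ℝ) : ℂ :=
  if u < 0 then -1
  else if u ≤ 2 * Real.pi then Complex.I * (ε : ℂ) * Complex.exp (Complex.I * (u : ℂ))
  else 1

/-- The power `x ^ w = exp (w (log |x| + i arg x))` at `x = hankelPoint ε u`, with the argument
that varies continuously from `0` to `2π` along the contour. -/
noncomputable def hankelPow (ε u : ℝ) (w : ℂ) : ℂ :=
  Complex.exp (w * ((Real.log (hankelRadius ε u) : ℂ) + Complex.I * (hankelArg u : ℂ)))

/-- The pulled-back integrand, at the parameters `u₁, …, u_r`, of
`∫_{C^r} ∏ⱼ K (xⱼ + ⋯ + x_r) ∏ₖ xₖ ^ (sₖ - 1) dxₖ`. -/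
noncomputable def hankelIntegrand (r : ℕ) (K : ℂ → ℂ) (ε : ℝ) (s : Fin r → ℂ)
    (u : Fin r → ℝ) : ℂ :=
  (∏ j : Fin r, K (∑ k ∈ Finset.Ici j, hankelPoint ε (u k))) *
    ∏ k : Fin r, (hankelPow ε (u k) (s k - 1) * hankelVelocity ε (u k))

/-- The `r`-fold contour integral `∫_{C^r} ∏ⱼ K (xⱼ + ⋯ + x_r) ∏ₖ xₖ ^ (sₖ - 1) dxₖ` over the
Hankel contour `C` of radius `ε`. -/
noncomputable def hankelIntegral (r : ℕ) (K : ℂ → ℂ) (ε : ℝ) (s : Fin r → ℂ) : ℂ :=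
  ∫ u : Fin r → ℝ, hankelIntegrand r K ε s u

/-- The factor `C(s) = ∏ₖ 1 / ((e ^ (2 π i sₖ) - 1) Γ(sₖ))`. -/
noncomputable def hankelFactor (r : ℕ) (s : Fin r → ℂ) : ℂ :=
  ∏ k : Fin r, 1 / ((Complex.exp (2 * (Real.pi : ℂ) * Complex.I * s k) - 1) * Complex.Gamma (s k))

/-- The kernel `1 / (e ^ y - 1) - c / (e ^ (c y) - 1)`, with the removable singularity at `y = 0`
filled by its limit `(c - 1) / 2`, the constant term of `∑_{m ≥ 1} (1 - c ^ m) B_m y ^ (m - 1) / m!`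
(with `B_1 = -1/2`). -/
noncomputable def desKernel (c : ℝ) (y : ℂ) : ℂ :=
  if y = 0 then ((c : ℂ) - 1) / 2
  else 1 / (Complex.exp y - 1) - (c : ℂ) / (Complex.exp ((c : ℂ) * y) - 1)

/-- The kernel `1 / (t⁻¹ e ^ y - 1) + (log t - y) t⁻¹ e ^ y / (t⁻¹ e ^ y - 1) ^ 2`, with the
removable singularity at `y = log t` filled by its limit `-1 / 2`. -/
noncomputable def hatKernel (t : ℝ) (y : ℂ) : ℂ :=
  if y = (Real.log t : ℂ) then -1 / 2
  else 1 / (1 / (t : ℂ) * Complex.exp y - 1) +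
    (((Real.log t : ℂ) - y) * (1 / (t : ℂ)) * Complex.exp y) /
      (1 / (t : ℂ) * Complex.exp y - 1) ^ 2

/-- All coordinates of `s` lie in `ℂ ∖ ℤ`. -/
def NonInteger {r : ℕ} (s : Fin r → ℂ) : Prop :=
  ∀ (k : Fin r) (n : ℤ), s k ≠ (n : ℂ)

/-- The radius of the circle in the Hankel contour is sufficiently small for `r`-fold integrals:
sums of at most `r` points of the contour then lie in `{|z| < 1}` or in a sector
`{|arg z| ≤ θ}` with `θ < π / 2`. -/
def SmallRadius (r : ℕ) (ε : ℝ) : Prop :=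
  0 < ε ∧ (r : ℝ) * ε < 1

/-- `Z` is the desingularized multiple zeta function of depth `r` on `ℂ ^ r`: it is entire, and on
`(ℂ ∖ ℤ) ^ r` it is the limit, as the real number `c ≠ 1` tends to `1`, of
`(1 - c) ^ (-r) C(s) ∫_{C^r} ∏ⱼ (1 / (e ^ yⱼ - 1) - c / (e ^ (c yⱼ) - 1)) ∏ₖ xₖ ^ (sₖ - 1) dxₖ`,
where `yⱼ = xⱼ + ⋯ + x_r`; the integrals converge absolutely for `c` near `1`. As `(ℂ ∖ ℤ) ^ r` is
dense, at most one `Z` has this property. -/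
def IsDesZeta (r : ℕ) (Z : (Fin r → ℂ) → ℂ) : Prop :=
  Differentiable ℂ Z ∧
    ∀ ε : ℝ, SmallRadius r ε → ∀ s : Fin r → ℂ, NonInteger s →
      (∀ᶠ c in nhdsWithin (1 : ℝ) {1}ᶜ,
        MeasureTheory.Integrable (hankelIntegrand r (desKernel c) ε s)) ∧
      Filter.Tendsto
        (fun c : ℝ =>
          1 / (1 - (c : ℂ)) ^ r * (hankelFactor r s * hankelIntegral r (desKernel c) ε s))
        (nhdsWithin (1 : ℝ) {1}ᶜ) (nhds (Z s))

/-- `Z` is the entire continuation to `ℂ ^ r` of the one-parameter desingularized multiple zeta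
function at `t`, which on `(ℂ ∖ ℤ) ^ r` is given by an absolutely convergent Hankel integral. As
`(ℂ ∖ ℤ) ^ r` is dense, at most one `Z` has this property. -/
def IsHatDesZeta (r : ℕ) (t : ℝ) (Z : (Fin r → ℂ) → ℂ) : Prop :=
  Differentiable ℂ Z ∧
    ∀ ε : ℝ, SmallRadius r ε → ∀ s : Fin r → ℂ, NonInteger s →
      MeasureTheory.Integrable (hankelIntegrand r (hatKernel t) ε s) ∧
      Z s = hankelFactor r s * hankelIntegral r (hatKernel t) ε s

end DesMZF

/-!
If `x` is uniform on `[0, 1]`, then `log x - log (1 - x)` has moment generating function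
`Γ(1 + z) Γ(1 - z) = π z / sin (π z)`. After a change of variables this exhibits `w / (e ^ w - 1)`,
and with it both kernels of the theorem, as superpositions `∫ φ e ^ (-α y)` of exponentials whose
frequencies satisfy `re α ≥ κ > 0`. Hankel's formula
`∫_C e ^ (-A x) x ^ (s - 1) dx = (e ^ (2 π i s) - 1) Γ(s) A ^ (-s)` and Fubini then turn
`C(s) ∫_{C ^ r}` into `∫ ∏ⱼ φ(tⱼ) ∏ₖ (α(t₁) + ⋯ + α(tₖ)) ^ (-sₖ)`, an integral of Euler–Zagier
type, in which the contour is gone and `s` is unrestricted. It is an entire function of `s`, and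
both limits pass under it by dominated convergence.
-/

namespace DesMZF

open Complex MeasureTheory Set Filter Topology

section IntegralsOfExponentials

variable {T E : Type*} [MeasurableSpace T] {μ : Measure T}

lemma differentiableAt_integral_mul_exp [NormedAddCommGroup E] [NormedSpace ℂ E]
    {w : T → ℂ} {L : T → E →L[ℂ] ℂ} {s : E} {δ : ℝ} (hδ : 0 < δ)
    (hw : AEStronglyMeasurable w μ) (hL : AEStronglyMeasurable L μ)
    (hint : Integrable (fun t => ‖w t * exp (L t s)‖ * Real.exp (δ * ‖L t‖)) μ) :
    DifferentiableAt ℂ (fun s' => ∫ t, w t * exp (L t s') ∂μ) s := by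
  have hmeas (s' : E) : AEStronglyMeasurable (fun t => w t * exp (L t s')) μ :=
    hw.mul (continuous_exp.comp_aestronglyMeasurable
      ((ContinuousLinearMap.apply ℂ ℂ s').continuous.comp_aestronglyMeasurable hL))
  refine (hasFDerivAt_integral_of_dominated_of_fderiv_le
    (F' := fun s' t => (w t * exp (L t s')) • L t)
    (bound := fun t => 2 / δ * (‖w t * exp (L t s)‖ * Real.exp (δ * ‖L t‖)))
    (Metric.ball_mem_nhds s (half_pos hδ)) (Eventually.of_forall hmeas) ?_
    ((hmeas s).smul hL) ?_ (hint.const_mul _) ?_).differentiableAt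
  · refine hint.mono' (hmeas s) (ae_of_all _ fun t => ?_)
    exact le_mul_of_one_le_right (norm_nonneg _) (Real.one_le_exp (by positivity))
  · refine ae_of_all _ fun t s' hs' => ?_
    have hclose : ‖L t (s' - s)‖ ≤ δ / 2 * ‖L t‖ :=
      ((L t).le_of_opNorm_le_of_le le_rfl (mem_ball_iff_norm.mp hs').le).trans_eq (mul_comm _ _)
    have hlinear : ‖L t‖ ≤ 2 / δ * Real.exp (δ / 2 * ‖L t‖) := by
      rw [div_mul_eq_mul_div, le_div_iff₀ hδ]
      linarith [Real.add_one_le_exp (δ / 2 * ‖L t‖)]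
    calc ‖(w t * exp (L t s')) • L t‖
        = ‖w t * exp (L t s)‖ * ‖exp (L t (s' - s))‖ * ‖L t‖ := by
          rw [norm_smul, ← norm_mul, mul_assoc, ← Complex.exp_add, map_sub, add_sub_cancel]
      _ ≤ ‖w t * exp (L t s)‖ * Real.exp (δ / 2 * ‖L t‖) *
            (2 / δ * Real.exp (δ / 2 * ‖L t‖)) := by
          gcongr
          exact (norm_exp_le_exp_norm _).trans (Real.exp_le_exp.mpr hclose)
      _ = 2 / δ * (‖w t * exp (L t s)‖ * Real.exp (δ * ‖L t‖)) := by
          rw [show δ * ‖L t‖ = δ / 2 * ‖L t‖ + δ / 2 * ‖L t‖ by ring, Real.exp_add]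
          ring
  · refine ae_of_all _ fun t s' _ => ?_
    simpa only [smul_smul] using ((L t).hasFDerivAt.cexp.const_mul (w t))

lemma differentiableAt_integral_mul_exp_mul {w g : T → ℂ} {s : ℂ} {δ : ℝ} (hδ : 0 < δ)
    (hw : AEStronglyMeasurable w μ) (hg : AEStronglyMeasurable g μ)
    (hint : Integrable (fun t => ‖w t * exp (g t * s)‖ * Real.exp (δ * ‖g t‖)) μ) :
    DifferentiableAt ℂ (fun s' => ∫ t, w t * exp (g t * s') ∂μ) s :=
  differentiableAt_integral_mul_exp (L := fun t => ContinuousLinearMap.mul ℂ ℂ (g t)) hδ hw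
    ((ContinuousLinearMap.mul ℂ ℂ).continuous.comp_aestronglyMeasurable hg) (by simpa using hint)

end IntegralsOfExponentials

section Mellin

lemma integrableOn_Ioi_zero_rpow_mul_exp_neg {κ σ : ℝ} (hκ : 0 < κ) (hσ : -1 < σ) :
    IntegrableOn (fun x : ℝ => x ^ σ * Real.exp (-κ * x)) (Ioi 0) := by
  simpa using integrableOn_rpow_mul_exp_neg_mul_rpow hσ one_pos hκ

lemma integrableOn_Ioi_rpow_mul_exp_neg {ε κ : ℝ} (hε : 0 < ε) (hκ : 0 < κ) (σ : ℝ) :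
    IntegrableOn (fun x : ℝ => x ^ σ * Real.exp (-κ * x)) (Ioi ε) := by
  refine integrable_of_isBigO_exp_neg (half_pos hκ) (fun x hx => ?_) ?_
  · exact ((Real.continuousAt_rpow_const x σ (Or.inl (hε.trans_le hx).ne')).mul
      (by fun_prop)).continuousWithinAt
  · refine ((isLittleO_rpow_exp_pos_mul_atTop σ (half_pos hκ)).isBigO.mul
      (Asymptotics.isBigO_refl (fun x : ℝ => Real.exp (-κ * x)) atTop)).congr_right fun x => ?_
    rw [← Real.exp_add]
    ring_nf

lemma norm_cpow_mul_exp_neg {x : ℝ} (hx : 0 < x) (s α : ℂ) :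
    ‖(x : ℂ) ^ s * exp (-α * x)‖ = x ^ s.re * Real.exp (-α.re * x) := by
  rw [norm_mul, norm_cpow_eq_rpow_re_of_pos hx, norm_exp]
  simp

lemma continuousOn_cpow_mul_exp_neg (s α : ℂ) :
    ContinuousOn (fun x : ℝ => (x : ℂ) ^ s * exp (-α * x)) (Ioi 0) := fun x hx =>
  ((continuousAt_ofReal_cpow_const x s (Or.inr (ne_of_gt hx))).mul
    (by fun_prop)).continuousWithinAt

lemma integrableOn_Ioi_cpow_mul_exp_neg {ε : ℝ} {α : ℂ} (hε : 0 < ε) (hα : 0 < α.re) (s : ℂ) :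
    IntegrableOn (fun x : ℝ => (x : ℂ) ^ s * exp (-α * x)) (Ioi ε) := by
  refine (integrableOn_Ioi_rpow_mul_exp_neg hε hα s.re).mono'
    (((continuousOn_cpow_mul_exp_neg s α).mono (Ioi_subset_Ioi hε.le)).aestronglyMeasurable
      measurableSet_Ioi) ?_
  filter_upwards [ae_restrict_mem measurableSet_Ioi] with x hx
  exact (norm_cpow_mul_exp_neg (hε.trans hx) s α).le

lemma integrableOn_Ioi_zero_cpow_mul_exp_neg {α s : ℂ} (hα : 0 < α.re) (hs : -1 < s.re) :
    IntegrableOn (fun x : ℝ => (x : ℂ) ^ s * exp (-α * x)) (Ioi 0) := by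
  refine (integrableOn_Ioi_zero_rpow_mul_exp_neg hα hs).mono'
    ((continuousOn_cpow_mul_exp_neg s α).aestronglyMeasurable measurableSet_Ioi) ?_
  filter_upwards [ae_restrict_mem measurableSet_Ioi] with x hx
  exact (norm_cpow_mul_exp_neg hx s α).le

lemma differentiableAt_integral_cpow_mul_exp_neg {α s : ℂ} (hα : 0 < α.re) (hs : -1 < s.re) :
    DifferentiableAt ℂ (fun α' => ∫ x in Ioi (0 : ℝ), (x : ℂ) ^ s * exp (-α' * x)) α := by
  have hcomm (v : ℂ) (x : ℝ) : -v * (x : ℂ) = -(x : ℂ) * v := by ring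
  simp_rw [hcomm]
  refine differentiableAt_integral_mul_exp_mul (half_pos hα) ?_ (by fun_prop) ?_
  · simpa using (continuousOn_cpow_mul_exp_neg s 0).aestronglyMeasurable measurableSet_Ioi
  · refine (integrableOn_Ioi_zero_rpow_mul_exp_neg (half_pos hα) hs).congr_fun
      (fun x (hx : 0 < x) => ?_) measurableSet_Ioi
    simp only [← hcomm, norm_cpow_mul_exp_neg hx, norm_neg, norm_real, Real.norm_of_nonneg hx.le]
    rw [mul_assoc, ← Real.exp_add]
    ring_nf

/-- Both sides are analytic in `α` on the right half-plane and agree for real `α`. -/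
lemma integral_cpow_mul_exp_neg_mul_of_re_pos {α s : ℂ} (hα : 0 < α.re) (hs : 0 < s.re) :
    ∫ x in Ioi (0 : ℝ), (x : ℂ) ^ (s - 1) * exp (-α * x) = Gamma s * α ^ (-s) := by
  have hopen : IsOpen {v : ℂ | 0 < v.re} := isOpen_lt continuous_const continuous_re
  have hF : DifferentiableOn ℂ
      (fun v : ℂ => ∫ x in Ioi (0 : ℝ), (x : ℂ) ^ (s - 1) * exp (-v * x)) {v : ℂ | 0 < v.re} :=
    fun v hv => (differentiableAt_integral_cpow_mul_exp_neg hv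
      (by simpa using hs)).differentiableWithinAt
  have hG : DifferentiableOn ℂ (fun v : ℂ => Gamma s * v ^ (-s)) {v : ℂ | 0 < v.re} :=
    fun v hv => ((differentiableAt_id.cpow_const (Or.inl hv)).const_mul _).differentiableWithinAt
  refine (hF.analyticOnNhd hopen).eqOn_of_preconnected_of_frequently_eq (hG.analyticOnNhd hopen)
    (convex_halfSpace_re_gt 0).isPreconnected (z₀ := 1) (by simp) ?_ hα
  have ht : Tendsto (fun x : ℝ => (x : ℂ)) (𝓝[≠] 1) (𝓝[≠] 1) := by
    refine tendsto_nhdsWithin_of_tendsto_nhds_of_eventually_within _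
      ((continuous_ofReal.tendsto' 1 1 (by simp)).mono_left nhdsWithin_le_nhds) ?_
    filter_upwards [self_mem_nhdsWithin] with x hx
    simpa using hx
  refine ht.frequently (Eventually.frequently ?_)
  filter_upwards [nhdsWithin_le_nhds (Ioi_mem_nhds (zero_lt_one (α := ℝ)))] with x (hx : 0 < x)
  have hreal := integral_cpow_mul_exp_neg_mul_Ioi hs hx
  simp only [← neg_mul] at hreal
  rw [hreal, one_div, inv_cpow _ _ (by rw [arg_ofReal_of_nonneg hx.le]; exact Real.pi_pos.ne),
    cpow_neg, mul_comm]

end Mellin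

section HankelFormula

/-- The integral of `e ^ (-α x) x ^ (s - 1)` over the circle of radius `ε` in the Hankel contour,
divided by `I`. -/
noncomputable def hankelCircle (α s : ℂ) (ε : ℝ) : ℂ :=
  ∫ θ in (0 : ℝ)..2 * Real.pi, exp (-α * exp (Real.log ε + θ * I)) * exp (s * (Real.log ε + θ * I))

/-- The integral of `e ^ (-α x) x ^ (s - 1)` over the half-line `x > ε`, for the principal branch
of the power, which is the one on the top side of the Hankel contour. -/
noncomputable def hankelRay (α s : ℂ) (ε : ℝ) : ℂ :=
  ∫ x in Ioi ε, (x : ℂ) ^ (s - 1) * exp (-α * x)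

lemma exp_mul_log_ofReal {ε : ℝ} (hε : 0 < ε) (s : ℂ) :
    exp (s * Real.log ε) = (ε : ℂ) ^ s := by
  rw [cpow_def_of_ne_zero (ofReal_ne_zero.mpr hε.ne'), ← ofReal_log hε.le, mul_comm]

lemma integral_exp_exp_eq_integral_cpow (α s : ℂ) {δ ε : ℝ} (hδ : 0 < δ) (hε : 0 < ε) :
    ∫ v in Real.log δ..Real.log ε, exp (-α * exp v) * exp (s * v) =
      ∫ x in δ..ε, (x : ℂ) ^ (s - 1) * exp (-α * x) := by
  have hsubst := intervalIntegral.integral_deriv_smul_comp''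
    (a := Real.log δ) (b := Real.log ε) (f := Real.exp) (f' := Real.exp)
    (g := fun x : ℝ => (x : ℂ) ^ (s - 1) * exp (-α * x)) Real.continuous_exp.continuousOn
    (fun x _ => (Real.hasDerivAt_exp x).hasDerivWithinAt) Real.continuous_exp.continuousOn
    ((continuousOn_cpow_mul_exp_neg _ _).mono (by rintro _ ⟨x, -, rfl⟩; exact Real.exp_pos x))
  rw [Real.exp_log hδ, Real.exp_log hε] at hsubst
  rw [← hsubst]
  refine intervalIntegral.integral_congr fun v _ => ?_
  simp only [Function.comp, real_smul]
  rw [← exp_mul_log_ofReal (Real.exp_pos v), Real.log_exp, ofReal_exp,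
    show s * v = v + (s - 1) * v by ring, Complex.exp_add]
  ring

/-- Cauchy's theorem in the logarithmic coordinate, where the annulus cut along the real axis is a
rectangle and the power `x ^ s` is the entire function `e ^ (s w)`. -/
lemma hankelCircle_sub_hankelCircle (α s : ℂ) {δ ε : ℝ} (hδ : 0 < δ) (hε : 0 < ε) :
    I * hankelCircle α s ε - I * hankelCircle α s δ =
      (exp (2 * Real.pi * I * s) - 1) * ∫ x in δ..ε, (x : ℂ) ^ (s - 1) * exp (-α * x) := by
  have cauchy := integral_boundary_rect_eq_zero_of_differentiableOn
    (fun w => exp (-α * exp w) * exp (s * w)) ⟨Real.log δ, 0⟩ ⟨Real.log ε, 2 * Real.pi⟩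
    (Differentiable.differentiableOn (by fun_prop))
  have hperiod (x : ℝ) : exp (-α * exp (x + ((2 * Real.pi : ℝ) : ℂ) * I)) *
      exp (s * (x + ((2 * Real.pi : ℝ) : ℂ) * I)) =
      exp (2 * Real.pi * I * s) * (exp (-α * exp x) * exp (s * x)) := by
    rw [Complex.exp_add (x : ℂ), mul_add s, Complex.exp_add (s * x)]
    push_cast
    rw [exp_two_pi_mul_I, mul_one]
    ring_nf
  simp only [smul_eq_mul, hperiod, intervalIntegral.integral_const_mul, ofReal_zero, zero_mul,
    add_zero, integral_exp_exp_eq_integral_cpow α s hδ hε] at cauchy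
  rw [← hankelCircle, ← hankelCircle] at cauchy
  linear_combination cauchy

lemma tendsto_hankelCircle_zero (α : ℂ) {s : ℂ} (hs : 0 < s.re) :
    Tendsto (hankelCircle α s) (𝓝[>] 0) (𝓝 0) := by
  set unitPart : ℝ → ℂ := fun ε =>
    ∫ θ in (0 : ℝ)..2 * Real.pi, exp (-α * (ε * exp (θ * I))) * exp (s * (θ * I))
  have hcont : Continuous unitPart :=
    intervalIntegral.continuous_parametric_intervalIntegral_of_continuous' (by fun_prop) _ _
  have hpow : ContinuousAt (fun ε : ℝ => (ε : ℂ) ^ s) 0 :=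
    continuousAt_ofReal_cpow_const 0 s (Or.inl hs)
  have hlim := (hpow.mul hcont.continuousAt).tendsto.mono_left (nhdsWithin_le_nhds (s := Ioi 0))
  simp only [Pi.mul_apply, ofReal_zero, zero_cpow (show s ≠ 0 by rintro rfl; simp at hs), zero_mul]
    at hlim
  refine hlim.congr' ?_
  filter_upwards [self_mem_nhdsWithin] with ε (hε : 0 < ε)
  simp only [Pi.mul_apply, unitPart, hankelCircle]
  rw [← intervalIntegral.integral_const_mul]
  refine intervalIntegral.integral_congr fun θ _ => ?_
  rw [Complex.exp_add (Real.log ε : ℂ), ← ofReal_exp, Real.exp_log hε, mul_add s, Complex.exp_add,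
    exp_mul_log_ofReal hε]
  ring

lemma hankelCircle_of_re_pos {α s : ℂ} (hα : 0 < α.re) (hs : 0 < s.re) {ε : ℝ} (hε : 0 < ε) :
    I * hankelCircle α s ε =
      (exp (2 * Real.pi * I * s) - 1) * ∫ x in (0 : ℝ)..ε, (x : ℂ) ^ (s - 1) * exp (-α * x) := by
  set f : ℝ → ℂ := fun x => (x : ℂ) ^ (s - 1) * exp (-α * x)
  set c := exp (2 * Real.pi * I * s) - 1
  have hint : IntegrableOn f (uIcc 0 ε) := by
    rw [uIcc_of_le hε.le, integrableOn_Icc_iff_integrableOn_Ioc]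
    exact (integrableOn_Ioi_zero_cpow_mul_exp_neg hα (by simpa using hs)).mono_set fun x hx => hx.1
  have hprim : Tendsto (fun δ => ∫ x in δ..ε, f x) (𝓝[>] 0) (𝓝 (∫ x in (0 : ℝ)..ε, f x)) := by
    have := intervalIntegral.continuousOn_primitive_interval_left hint 0 left_mem_uIcc
    rw [ContinuousWithinAt, uIcc_of_le hε.le] at this
    exact this.mono_left (nhdsWithin_le_of_mem (Icc_mem_nhdsGT hε))
  have hlim := (tendsto_const_nhds (x := I * hankelCircle α s ε)).sub
    ((tendsto_hankelCircle_zero α hs).const_mul I)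
  rw [mul_zero, sub_zero] at hlim
  refine tendsto_nhds_unique hlim ((hprim.const_mul c).congr' ?_)
  filter_upwards [self_mem_nhdsWithin] with δ (hδ : 0 < δ)
  exact (hankelCircle_sub_hankelCircle α s hδ hε).symm

lemma hankel_formula_of_re_pos {α s : ℂ} (hα : 0 < α.re) (hs : 0 < s.re) {ε : ℝ} (hε : 0 < ε) :
    (exp (2 * Real.pi * I * s) - 1) * hankelRay α s ε + I * hankelCircle α s ε =
      (exp (2 * Real.pi * I * s) - 1) * (Gamma s * α ^ (-s)) := by
  have hint := integrableOn_Ioi_zero_cpow_mul_exp_neg hα (s := s - 1) (by simpa using hs)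
  rw [hankelCircle_of_re_pos hα hs hε, ← mul_add, ← integral_cpow_mul_exp_neg_mul_of_re_pos hα hs,
    hankelRay, add_comm, intervalIntegral.integral_interval_add_Ioi hint
      (hint.mono_set (Ioi_subset_Ioi hε.le))]

lemma differentiable_hankelCircle (α : ℂ) (ε : ℝ) :
    Differentiable ℂ fun s => hankelCircle α s ε := by
  intro s
  simp_rw [hankelCircle, intervalIntegral.integral_of_le Real.two_pi_pos.le, mul_comm _ (_ + _)]
  exact differentiableAt_integral_mul_exp_mul one_pos (by fun_prop) (by fun_prop)
    (Continuous.integrableOn_Ioc (by fun_prop))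

lemma differentiable_hankelRay {α : ℂ} (hα : 0 < α.re) {ε : ℝ} (hε : 0 < ε) :
    Differentiable ℂ fun s => hankelRay α s ε := by
  intro s
  have hsplit (s' : ℂ) : hankelRay α s' ε =
      ∫ x in Ioi ε, (x : ℂ) ^ (-1 : ℂ) * exp (-α * x) * exp (Real.log x * s') := by
    refine setIntegral_congr_fun measurableSet_Ioi fun x hx => ?_
    have hx0 : 0 < x := hε.trans hx
    simp only [mul_comm (Real.log x : ℂ) s', exp_mul_log_ofReal hx0]
    rw [sub_eq_add_neg, cpow_add _ _ (ofReal_ne_zero.mpr hx0.ne')]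
    ring
  simp_rw [hsplit]
  have hcont (w : ℂ) : AEStronglyMeasurable (fun x : ℝ => (x : ℂ) ^ w * exp (-α * x))
      (volume.restrict (Ioi ε)) := (integrableOn_Ioi_cpow_mul_exp_neg hε hα w).aestronglyMeasurable
  have hlog : AEStronglyMeasurable (fun x : ℝ => (Real.log x : ℂ)) (volume.restrict (Ioi ε)) :=
    (measurable_ofReal.comp Real.measurable_log).aestronglyMeasurable
  refine differentiableAt_integral_mul_exp_mul one_pos (hcont _) hlog ?_
  refine (((integrableOn_Ioi_cpow_mul_exp_neg hε hα s).norm).add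
    (integrableOn_Ioi_cpow_mul_exp_neg hε hα (s - 2)).norm).mono' (by fun_prop) ?_
  filter_upwards [ae_restrict_mem measurableSet_Ioi] with x hx
  have hx0 : 0 < x := hε.trans hx
  have hexp : Real.exp |Real.log x| ≤ x + x⁻¹ := by
    simpa only [Real.exp_neg, Real.exp_log hx0] using Real.exp_abs_le (Real.log x)
  have hnorm : ‖(x : ℂ) ^ (-1 : ℂ) * exp (-α * x) * exp (Real.log x * s)‖ =
      x⁻¹ * x ^ s.re * Real.exp (-α.re * x) := by
    rw [mul_right_comm, mul_assoc, mul_comm (Real.log x : ℂ) s, exp_mul_log_ofReal hx0, norm_mul,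
      norm_cpow_mul_exp_neg hx0, norm_cpow_eq_rpow_re_of_pos hx0, ← mul_assoc]
    simp [Real.rpow_neg_one]
  simp only [hnorm, Pi.add_apply, norm_cpow_mul_exp_neg hx0, one_mul, norm_real, Real.norm_eq_abs,
    abs_mul, Real.abs_exp, abs_inv, abs_of_pos hx0, abs_of_pos (Real.rpow_pos_of_pos hx0 _)]
  calc x⁻¹ * x ^ s.re * Real.exp (-α.re * x) * Real.exp |Real.log x|
      ≤ x⁻¹ * x ^ s.re * Real.exp (-α.re * x) * (x + x⁻¹) := by gcongr
    _ = x ^ s.re * Real.exp (-α.re * x) + x ^ (s - 2).re * Real.exp (-α.re * x) := by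
      rw [sub_re, re_ofNat, Real.rpow_sub hx0, Real.rpow_two]
      field_simp

lemma hankel_formula {α : ℂ} (hα : 0 < α.re) {ε : ℝ} (hε : 0 < ε) {s : ℂ}
    (hs : ∀ n : ℕ, s ≠ -n) :
    (exp (2 * Real.pi * I * s) - 1) * hankelRay α s ε + I * hankelCircle α s ε =
      (exp (2 * Real.pi * I * s) - 1) * (Gamma s * α ^ (-s)) := by
  have hα0 : α ≠ 0 := by rintro rfl; simp at hα
  have hF : Differentiable ℂ fun s => ((exp (2 * Real.pi * I * s) - 1) * hankelRay α s ε +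
      I * hankelCircle α s ε) * (Gamma s)⁻¹ :=
    (((by fun_prop : Differentiable ℂ fun s => exp (2 * Real.pi * I * s) - 1).mul
      (differentiable_hankelRay hα hε)).add ((differentiable_hankelCircle α ε).const_mul I)).mul
      differentiable_one_div_Gamma
  have hG : Differentiable ℂ fun s => (exp (2 * Real.pi * I * s) - 1) * α ^ (-s) :=
    (by fun_prop : Differentiable ℂ fun s => exp (2 * Real.pi * I * s) - 1).mul
      (differentiable_neg.const_cpow (Or.inl hα0))
  have heq := AnalyticOnNhd.eq_of_eventuallyEq (fun z _ => hF.analyticAt z)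
    (fun z _ => hG.analyticAt z) (z₀ := 1) ?_
  · have h := congrFun heq s
    rw [← div_eq_mul_inv, div_eq_iff (Gamma_ne_zero hs)] at h
    rw [h]
    ring
  · filter_upwards [(isOpen_lt continuous_const continuous_re).mem_nhds
      (show (0 : ℝ) < (1 : ℂ).re by simp)] with z hz
    rw [hankel_formula_of_re_pos hα hz hε]
    field_simp [Gamma_ne_zero_of_re_pos hz]

end HankelFormula

section ChangeOfVariable

variable {E : Type*} [NormedAddCommGroup E]

lemma integrableOn_Iio_comp_sub_left (f : ℝ → E) (a c : ℝ) (hf : IntegrableOn f (Ioi (c - a))) :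
    IntegrableOn (fun u => f (c - u)) (Iio a) := by
  rw [← sub_sub_cancel c a, ← preimage_const_sub_Ioi]
  exact ((Measure.measurePreserving_sub_left volume c).integrableOn_comp_preimage
    (Homeomorph.subLeft c).measurableEmbedding).mpr hf

lemma integrableOn_Ioi_comp_add_right (f : ℝ → E) (a c : ℝ) (hf : IntegrableOn f (Ioi (a + c))) :
    IntegrableOn (fun u => f (u + c)) (Ioi a) := by
  rw [← add_sub_cancel_right a c, ← preimage_add_const_Ioi]
  exact ((measurePreserving_add_right volume c).integrableOn_comp_preimage
    (Homeomorph.addRight c).measurableEmbedding).mpr hf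

lemma integrable_of_integrableOn_Iio_Icc_Ioi {f : ℝ → E} {a b : ℝ} (hab : a ≤ b)
    (h₁ : IntegrableOn f (Iio a)) (h₂ : IntegrableOn f (Icc a b)) (h₃ : IntegrableOn f (Ioi b)) :
    Integrable f := by
  have h := (h₁.union h₂).union h₃
  rwa [Iio_union_Icc_eq_Iic hab, Iic_union_Ioi, integrableOn_univ] at h

variable [NormedSpace ℝ E]

lemma integral_Iio_comp_sub_left (f : ℝ → E) (a c : ℝ) :
    ∫ u in Iio a, f (c - u) = ∫ x in Ioi (c - a), f x := by
  rw [← (Measure.measurePreserving_sub_left volume c).setIntegral_preimage_emb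
    (Homeomorph.subLeft c).measurableEmbedding f (Ioi (c - a)), preimage_const_sub_Ioi,
    sub_sub_cancel]

lemma integral_Ioi_comp_add_right (f : ℝ → E) (a c : ℝ) :
    ∫ u in Ioi a, f (u + c) = ∫ x in Ioi (a + c), f x := by
  rw [← (measurePreserving_add_right volume c).setIntegral_preimage_emb
    (Homeomorph.addRight c).measurableEmbedding f (Ioi (a + c)), preimage_add_const_Ioi,
    add_sub_cancel_right]

lemma integral_eq_Iio_add_Icc_add_Ioi {f : ℝ → E} {a b : ℝ} (hab : a ≤ b) (hf : Integrable f) :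
    ∫ u, f u = (∫ u in Iio a, f u) + (∫ u in Icc a b, f u) + ∫ u in Ioi b, f u := by
  rw [← setIntegral_union ((Iio_disjoint_Ici le_rfl).mono_right Icc_subset_Ici_self)
      measurableSet_Icc hf.integrableOn hf.integrableOn, Iio_union_Icc_eq_Iic hab,
    ← setIntegral_union (Iic_disjoint_Ioi le_rfl) measurableSet_Ioi hf.integrableOn
      hf.integrableOn, Iic_union_Ioi, setIntegral_univ]

end ChangeOfVariable

section HankelContour

variable {ε u : ℝ}

/-- The one-variable factor `x ^ (s - 1) dx` of the pulled-back integrand. -/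
noncomputable def hankelWeight (ε : ℝ) (s : ℂ) (u : ℝ) : ℂ :=
  hankelPow ε u (s - 1) * hankelVelocity ε u

@[fun_prop]
lemma measurable_hankelRadius (ε : ℝ) : Measurable (hankelRadius ε) :=
  Measurable.ite measurableSet_Iio (by fun_prop)
    (Measurable.ite measurableSet_Iic (by fun_prop) (by fun_prop))

@[fun_prop]
lemma measurable_hankelArg : Measurable hankelArg :=
  Measurable.ite measurableSet_Iio (by fun_prop)
    (Measurable.ite measurableSet_Iic (by fun_prop) (by fun_prop))

@[fun_prop]
lemma measurable_hankelVelocity (ε : ℝ) : Measurable (hankelVelocity ε) :=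
  Measurable.ite measurableSet_Iio (by fun_prop)
    (Measurable.ite measurableSet_Iic (by fun_prop) (by fun_prop))

@[fun_prop]
lemma measurable_hankelPoint (ε : ℝ) : Measurable (hankelPoint ε) := by
  unfold hankelPoint
  fun_prop

@[fun_prop]
lemma measurable_hankelWeight (ε : ℝ) (s : ℂ) : Measurable (hankelWeight ε s) := by
  unfold hankelWeight hankelPow
  fun_prop

lemma hankelRadius_of_neg (hu : u < 0) : hankelRadius ε u = ε - u := by
  simp [hankelRadius, hu]

lemma hankelRadius_of_mem_Icc (hu : u ∈ Icc 0 (2 * Real.pi)) : hankelRadius ε u = ε := by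
  simp [hankelRadius, hu.1.not_gt, hu.2]

lemma hankelRadius_of_two_pi_lt (hu : 2 * Real.pi < u) :
    hankelRadius ε u = u + (ε - 2 * Real.pi) := by
  rw [hankelRadius, if_neg (Real.two_pi_pos.trans hu).not_gt, if_neg hu.not_ge]
  ring

lemma hankelPoint_of_neg (hu : u < 0) : hankelPoint ε u = hankelRadius ε u := by
  simp [hankelPoint, hankelArg, hu]

lemma hankelPoint_of_mem_Icc (hu : u ∈ Icc 0 (2 * Real.pi)) :
    hankelPoint ε u = ε * exp (I * u) := by
  simp [hankelPoint, hankelRadius_of_mem_Icc hu, hankelArg, hu.1.not_gt, hu.2]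

lemma hankelPoint_of_two_pi_lt (hu : 2 * Real.pi < u) : hankelPoint ε u = hankelRadius ε u := by
  have hturn : exp (I * (2 * Real.pi)) = 1 := by rw [mul_comm, exp_two_pi_mul_I]
  simp [hankelPoint, hankelArg, (Real.two_pi_pos.trans hu).not_gt, hu.not_ge, hturn]

lemma hankelWeight_of_neg (hε : 0 < ε) (hu : u < 0) (s : ℂ) :
    hankelWeight ε s u = -(hankelRadius ε u : ℂ) ^ (s - 1) := by
  rw [← exp_mul_log_ofReal (by rw [hankelRadius_of_neg hu]; linarith)]
  simp [hankelWeight, hankelPow, hankelVelocity, hankelArg, hu]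

lemma hankelWeight_of_mem_Icc (hε : 0 < ε) (hu : u ∈ Icc 0 (2 * Real.pi)) (s : ℂ) :
    hankelWeight ε s u = I * exp (s * (Real.log ε + u * I)) := by
  have hlog : (ε : ℂ) = exp (Real.log ε : ℂ) := by rw [← ofReal_exp, Real.exp_log hε]
  simp only [hankelWeight, hankelPow, hankelVelocity, hankelRadius_of_mem_Icc hu, hankelArg,
    hu.1.not_gt, hu.2, if_true, if_false]
  rw [show I * (ε : ℂ) * exp (I * u) = I * exp (Real.log ε + I * u) by
    rw [Complex.exp_add, ← hlog, mul_assoc], mul_left_comm, ← Complex.exp_add]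
  ring_nf

lemma hankelWeight_of_two_pi_lt (hε : 0 < ε) (hu : 2 * Real.pi < u) (s : ℂ) :
    hankelWeight ε s u = exp (2 * Real.pi * I * s) * (hankelRadius ε u : ℂ) ^ (s - 1) := by
  have hturn : exp (2 * Real.pi * I * s) = exp ((s - 1) * (I * (2 * Real.pi : ℝ))) := by
    rw [show (s - 1) * (I * (2 * Real.pi : ℝ)) = 2 * Real.pi * I * s - 2 * Real.pi * I by
      push_cast; ring, Complex.exp_sub, exp_two_pi_mul_I, div_one]
  rw [← exp_mul_log_ofReal (by rw [hankelRadius_of_two_pi_lt hu]; linarith)]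
  simp only [hankelWeight, hankelPow, hankelVelocity, hankelArg,
    (Real.two_pi_pos.trans hu).not_gt, hu.not_ge, if_false, mul_one]
  rw [hturn, ← Complex.exp_add]
  ring_nf

lemma hankelPoint_eq_radius_or_norm_eq (hε : 0 < ε) (u : ℝ) :
    (hankelPoint ε u = hankelRadius ε u ∧ 0 < hankelRadius ε u) ∨
      (‖hankelPoint ε u‖ = ε ∧ hankelRadius ε u = ε) := by
  rcases lt_or_ge u 0 with hneg | hnonneg
  · exact .inl ⟨hankelPoint_of_neg hneg, by rw [hankelRadius_of_neg hneg]; linarith⟩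
  rcases le_or_gt u (2 * Real.pi) with hle | hgt
  · refine .inr ⟨?_, hankelRadius_of_mem_Icc ⟨hnonneg, hle⟩⟩
    rw [hankelPoint_of_mem_Icc ⟨hnonneg, hle⟩, mul_comm I, norm_mul, norm_exp_ofReal_mul_I,
      mul_one, norm_real, Real.norm_of_nonneg hε.le]
  · exact .inl ⟨hankelPoint_of_two_pi_lt hgt, by rw [hankelRadius_of_two_pi_lt hgt]; linarith⟩

lemma abs_im_hankelPoint_le (hε : 0 < ε) (u : ℝ) : |(hankelPoint ε u).im| ≤ ε := by
  rcases hankelPoint_eq_radius_or_norm_eq hε u with hreal | hcircle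
  · simpa [hreal.1] using hε.le
  · exact (abs_im_le_norm _).trans hcircle.1.le

lemma norm_exp_neg_mul_hankelPoint_le {κ : ℝ} (hε : 0 < ε) (hκ : 0 ≤ κ) {A : ℂ} (hA : κ ≤ A.re)
    (u : ℝ) :
    ‖exp (-A * hankelPoint ε u)‖ ≤
      Real.exp (-κ * hankelRadius ε u) * Real.exp (ε * (‖A‖ + κ)) := by
  rw [← Real.exp_add]
  rcases hankelPoint_eq_radius_or_norm_eq hε u with ⟨hreal, hpos⟩ | ⟨hcircle, hradius⟩
  · rw [hreal, norm_exp, Real.exp_le_exp, re_mul_ofReal, neg_re]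
    have : 0 ≤ ε * (‖A‖ + κ) := by positivity
    linarith [mul_le_mul_of_nonneg_right hA hpos.le]
  · refine (norm_exp_le_exp_norm _).trans (Real.exp_le_exp.mpr ?_)
    rw [norm_mul, norm_neg, hcircle, hradius]
    linarith

lemma integrable_exp_neg_hankelRadius_mul_norm_hankelWeight {κ : ℝ} (hε : 0 < ε) (hκ : 0 < κ)
    (s : ℂ) :
    Integrable (fun u => Real.exp (-κ * hankelRadius ε u) * ‖hankelWeight ε s u‖) := by
  have hray := integrableOn_Ioi_rpow_mul_exp_neg hε hκ (s.re - 1)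
  refine integrable_of_integrableOn_Iio_Icc_Ioi Real.two_pi_pos.le ?_ ?_ ?_
  · refine (integrableOn_Iio_comp_sub_left _ 0 ε (by simpa using hray)).congr_fun
      (fun u (hu : u < 0) => ?_) measurableSet_Iio
    have hpos : 0 < ε - u := by linarith
    simp only [hankelWeight_of_neg hε hu, hankelRadius_of_neg hu, norm_neg,
      norm_cpow_eq_rpow_re_of_pos hpos, sub_re, one_re]
    ring_nf
  · have hcircle : Continuous fun u : ℝ =>
        Real.exp (-κ * ε) * ‖I * exp (s * (Real.log ε + u * I))‖ := by fun_prop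
    refine hcircle.integrableOn_Icc.congr_fun (fun u hu => ?_) measurableSet_Icc
    simp only [hankelRadius_of_mem_Icc hu, hankelWeight_of_mem_Icc hε hu]
  · have hshift := integrableOn_Ioi_comp_add_right _ (2 * Real.pi) (ε - 2 * Real.pi)
      (by simpa using hray)
    refine IntegrableOn.congr_fun (hshift.const_mul ‖exp (2 * Real.pi * I * s)‖)
      (fun u (hu : 2 * Real.pi < u) => ?_) measurableSet_Ioi
    have hpos : 0 < u + (ε - 2 * Real.pi) := by linarith
    simp only [hankelWeight_of_two_pi_lt hε hu, hankelRadius_of_two_pi_lt hu, norm_mul,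
      norm_cpow_eq_rpow_re_of_pos hpos, sub_re, one_re]
    ring_nf

lemma integrable_exp_neg_mul_hankelWeight (hε : 0 < ε) {A : ℂ} (hA : 0 < A.re) (s : ℂ) :
    Integrable (fun u => exp (-A * hankelPoint ε u) * hankelWeight ε s u) := by
  refine ((integrable_exp_neg_hankelRadius_mul_norm_hankelWeight hε hA s).const_mul
    (Real.exp (ε * (‖A‖ + A.re)))).mono' (by fun_prop) (ae_of_all _ fun u => ?_)
  rw [norm_mul, ← mul_assoc, mul_comm (Real.exp (ε * _))]
  gcongr
  exact norm_exp_neg_mul_hankelPoint_le hε hA.le le_rfl u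

lemma integral_exp_neg_mul_hankelWeight (hε : 0 < ε) {A s : ℂ} (hA : 0 < A.re)
    (hs : ∀ n : ℕ, s ≠ -n) :
    ∫ u, exp (-A * hankelPoint ε u) * hankelWeight ε s u =
      (exp (2 * Real.pi * I * s) - 1) * (Gamma s * A ^ (-s)) := by
  have htop : ∫ u in Iio 0, exp (-A * hankelPoint ε u) * hankelWeight ε s u =
      -hankelRay A s ε := by
    rw [hankelRay, ← sub_zero ε, ← integral_Iio_comp_sub_left, ← integral_neg]
    refine setIntegral_congr_fun measurableSet_Iio fun u (hu : u < 0) => ?_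
    simp only [sub_zero, hankelPoint_of_neg hu, hankelWeight_of_neg hε hu, hankelRadius_of_neg hu]
    ring
  have hcircle : ∫ u in Icc 0 (2 * Real.pi), exp (-A * hankelPoint ε u) * hankelWeight ε s u =
      I * hankelCircle A s ε := by
    have hlog : exp (Real.log ε : ℂ) = ε := by rw [← ofReal_exp, Real.exp_log hε]
    rw [hankelCircle, intervalIntegral.integral_of_le Real.two_pi_pos.le,
      ← integral_Icc_eq_integral_Ioc, ← integral_const_mul]
    refine setIntegral_congr_fun measurableSet_Icc fun u hu => ?_
    simp only [hankelPoint_of_mem_Icc hu, hankelWeight_of_mem_Icc hε hu, Complex.exp_add _ (u * I),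
      hlog, mul_comm I (u : ℂ)]
    ring
  have hbottom : ∫ u in Ioi (2 * Real.pi), exp (-A * hankelPoint ε u) * hankelWeight ε s u =
      exp (2 * Real.pi * I * s) * hankelRay A s ε := by
    rw [hankelRay, ← add_sub_cancel (2 * Real.pi) ε, ← integral_Ioi_comp_add_right,
      ← integral_const_mul]
    refine setIntegral_congr_fun measurableSet_Ioi fun u (hu : 2 * Real.pi < u) => ?_
    simp only [add_sub_cancel, hankelPoint_of_two_pi_lt hu, hankelWeight_of_two_pi_lt hε hu,
      hankelRadius_of_two_pi_lt hu]
    ring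
  rw [integral_eq_Iio_add_Icc_add_Ioi Real.two_pi_pos.le
    (integrable_exp_neg_mul_hankelWeight hε hA s), htop, hcircle, hbottom]
  linear_combination hankel_formula hA hε hs

end HankelContour

section PrefixSums

variable {r : ℕ}

/-- The partial sum `z₁ + ⋯ + z_k`, the frequency dual to the point `x_k` of the contour. -/
noncomputable def prefixSum (z : Fin r → ℂ) (k : Fin r) : ℂ :=
  ∑ j ∈ Finset.Iic k, z j

lemma sum_mul_sum_Ici_eq_sum_prefixSum_mul (z x : Fin r → ℂ) :
    ∑ j, z j * ∑ k ∈ Finset.Ici j, x k = ∑ k, prefixSum z k * x k := by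
  simp_rw [prefixSum, Finset.mul_sum, Finset.sum_mul]
  exact Finset.sum_comm' fun i j => by simp

lemma le_re_prefixSum {κ : ℝ} (hκ : 0 ≤ κ) {z : Fin r → ℂ} (hz : ∀ j, κ ≤ (z j).re)
    (k : Fin r) : κ ≤ (prefixSum z k).re := by
  rw [prefixSum, re_sum]
  exact (hz k).trans (Finset.single_le_sum (f := fun j => (z j).re)
    (fun j _ => hκ.trans (hz j)) (Finset.mem_Iic.mpr le_rfl))

lemma norm_prefixSum_le (z : Fin r → ℂ) (k : Fin r) : ‖prefixSum z k‖ ≤ ∑ j, ‖z j‖ :=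
  (norm_sum_le _ _).trans
    (Finset.sum_le_sum_of_subset_of_nonneg (Finset.subset_univ _) fun _ _ _ => norm_nonneg _)

lemma exists_norm_log_le_mul_norm_add {κ η : ℝ} (hκ : 0 < κ) (hη : 0 < η) :
    ∃ C : ℝ, ∀ A : ℂ, κ ≤ A.re → ‖log A‖ ≤ η * ‖A‖ + C := by
  refine ⟨|Real.log κ| + |Real.log η| + Real.pi, fun A hA => ?_⟩
  have hκA : κ ≤ ‖A‖ := hA.trans (re_le_norm A)
  have hA0 : 0 < ‖A‖ := hκ.trans_le hκA
  have hnorm : ‖log A‖ ≤ |Real.log ‖A‖| + Real.pi := by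
    refine (norm_le_abs_re_add_abs_im (log A)).trans ?_
    rw [log_re, log_im]
    gcongr
    exact abs_arg_le_pi A
  have hlog : |Real.log ‖A‖| ≤ η * ‖A‖ + |Real.log κ| + |Real.log η| := by
    have hprod := Real.log_le_sub_one_of_pos (mul_pos hη hA0)
    rw [Real.log_mul hη.ne' hA0.ne'] at hprod
    rw [abs_le]
    constructor
    · linarith [Real.log_le_log hκ hκA, neg_abs_le (Real.log κ), abs_nonneg (Real.log η),
        mul_pos hη hA0]
    · linarith [neg_abs_le (Real.log η), abs_nonneg (Real.log κ)]
  linarith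

lemma exists_exp_sum_norm_log_prefixSum_le (r : ℕ) {κ : ℝ} (hκ : 0 < κ) {N : ℝ} (hN : 0 ≤ N) :
    ∃ C : ℝ, ∀ z : Fin r → ℂ, (∀ j, κ ≤ (z j).re) →
      Real.exp (N * ∑ k, ‖log (prefixSum z k)‖) ≤ Real.exp C * ∏ j, Real.exp ‖z j‖ := by
  have hη : 0 < 1 / ((N + 1) * (r + 1)) := by positivity
  obtain ⟨C, hC⟩ := exists_norm_log_le_mul_norm_add hκ hη
  refine ⟨N * (r * C), fun z hz => ?_⟩
  rw [← Real.exp_sum, ← Real.exp_add, Real.exp_le_exp]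
  set S := ∑ j, ‖z j‖
  have hS : 0 ≤ S := Finset.sum_nonneg fun _ _ => norm_nonneg _
  have hsmall : N * (r * (1 / ((N + 1) * (r + 1)))) ≤ 1 := by
    rw [← mul_assoc, mul_one_div, div_le_one (by positivity)]
    gcongr <;> linarith
  calc N * ∑ k, ‖log (prefixSum z k)‖
      ≤ N * ∑ _k : Fin r, (1 / ((N + 1) * (r + 1)) * S + C) := by
        gcongr with k
        exact (hC _ (le_re_prefixSum hκ.le hz k)).trans (by gcongr; exact norm_prefixSum_le z k)
    _ = N * (r * C) + N * (r * (1 / ((N + 1) * (r + 1)))) * S := by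
        rw [Finset.sum_const, Finset.card_univ, Fintype.card_fin, nsmul_eq_mul]
        ring
    _ ≤ N * (r * C) + S := by gcongr; exact mul_le_of_le_one_left hS hsmall

/-- The exponent of `∏ₖ (z₁ + ⋯ + z_k) ^ sₖ`, as a linear form in `s`. -/
noncomputable def logForm (z : Fin r → ℂ) : (Fin r → ℂ) →L[ℂ] ℂ :=
  ∑ k, log (prefixSum z k) • ContinuousLinearMap.proj (R := ℂ) (φ := fun _ : Fin r => ℂ) k

lemma logForm_apply (z s : Fin r → ℂ) : logForm z s = ∑ k, log (prefixSum z k) * s k := by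
  simp [logForm]

lemma norm_logForm_le (z : Fin r → ℂ) : ‖logForm z‖ ≤ ∑ k, ‖log (prefixSum z k)‖ := by
  refine ContinuousLinearMap.opNorm_le_bound _ (Finset.sum_nonneg fun _ _ => norm_nonneg _)
    fun s => ?_
  rw [logForm_apply, Finset.sum_mul]
  refine (norm_sum_le _ _).trans (Finset.sum_le_sum fun k _ => ?_)
  rw [norm_mul]
  gcongr
  exact norm_le_pi_norm s k

lemma prod_prefixSum_cpow_neg {κ : ℝ} (hκ : 0 < κ) {z : Fin r → ℂ} (hz : ∀ j, κ ≤ (z j).re)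
    (s : Fin r → ℂ) : ∏ k, prefixSum z k ^ (-s k) = exp (logForm z (-s)) := by
  rw [logForm_apply, Complex.exp_sum]
  refine Finset.prod_congr rfl fun k _ => cpow_def_of_ne_zero (ne_zero_of_re_pos ?_) _
  exact hκ.trans_le (le_re_prefixSum hκ.le hz k)

lemma norm_exp_logForm_mul_exp_le (z s : Fin r → ℂ) {δ : ℝ} (hδ : 0 ≤ δ) :
    ‖exp (logForm z s)‖ * Real.exp (δ * ‖logForm z‖) ≤
      Real.exp ((‖s‖ + δ) * ∑ k, ‖log (prefixSum z k)‖) := by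
  rw [add_mul, Real.exp_add]
  gcongr
  · refine (norm_exp_le_exp_norm _).trans (Real.exp_le_exp.mpr ?_)
    rw [mul_comm]
    exact (logForm z).le_of_opNorm_le (norm_logForm_le z) s
  · exact norm_logForm_le z

end PrefixSums

section MultiZeta

variable {T : Type*} [MeasurableSpace T] {μ : Measure T} {κ : ℝ} {α φ : T → ℂ} {r : ℕ}

/-- The data of a superposition `y ↦ ∫ φ e ^ (-α y) dμ` of decaying exponentials: the frequencies
`α` stay to the right of the line `re = κ`, and the density `φ` has an exponential moment which
makes the superposition converge for `|y| ≤ 1`. -/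
structure IsExpDensity (μ : Measure T) (κ : ℝ) (α φ : T → ℂ) : Prop where
  pos : 0 < κ
  measurable_frequency : Measurable α
  measurable_density : Measurable φ
  le_re (t : T) : κ ≤ (α t).re
  integrable : Integrable (fun t => ‖φ t‖ * Real.exp ‖α t‖) μ

/-- The superposition of the exponentials `e ^ (-α y)` with density `φ`. -/
noncomputable def expTransform (μ : Measure T) (α φ : T → ℂ) (y : ℂ) : ℂ :=
  ∫ t, φ t * exp (-α t * y) ∂μ

/-- The multiple zeta function `∫ ∏ⱼ φ(tⱼ) ∏ₖ (α(t₁) + ⋯ + α(t_k)) ^ (-sₖ)` of a density; for the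
counting measure on the positive integers, `α(n) = n` and `φ = 1` it is the Euler–Zagier sum. -/
noncomputable def multiZeta (r : ℕ) (μ : Measure T) (α φ : T → ℂ) (s : Fin r → ℂ) : ℂ :=
  ∫ t : Fin r → T, (∏ j, φ (t j)) * ∏ k, prefixSum (fun j => α (t j)) k ^ (-s k)
    ∂Measure.pi fun _ => μ

lemma measurable_prefixSum (hα : Measurable α) (k : Fin r) :
    Measurable fun t : Fin r → T => prefixSum (fun j => α (t j)) k := by
  unfold prefixSum
  fun_prop

lemma aestronglyMeasurable_logForm (hα : Measurable α) (ν : Measure (Fin r → T)) :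
    AEStronglyMeasurable (fun t => logForm fun j => α (t j)) ν :=
  Finset.aestronglyMeasurable_fun_sum _ fun k _ =>
    ((measurable_prefixSum hα k).clog.aestronglyMeasurable).smul_const _

lemma multiZeta_eq_integral_exp_logForm (h : IsExpDensity μ κ α φ) (s : Fin r → ℂ) :
    multiZeta r μ α φ s =
      ∫ t : Fin r → T, (∏ j, φ (t j)) * exp (logForm (fun j => α (t j)) (-s))
        ∂Measure.pi fun _ => μ := by
  simp only [multiZeta, prod_prefixSum_cpow_neg h.pos fun _ => h.le_re _]

variable [SigmaFinite μ]

lemma integrable_prod_density (h : IsExpDensity μ κ α φ) (r : ℕ) :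
    Integrable (fun t : Fin r → T => ∏ j, (‖φ (t j)‖ * Real.exp ‖α (t j)‖))
      (Measure.pi fun _ => μ) :=
  Integrable.fintype_prod fun _ => h.integrable

theorem differentiable_multiZeta (h : IsExpDensity μ κ α φ) :
    Differentiable ℂ (multiZeta r μ α φ) := by
  have hφ : AEStronglyMeasurable (fun t : Fin r → T => ∏ j, φ (t j)) (Measure.pi fun _ => μ) :=
    (Finset.measurable_fun_prod _ fun j _ =>
      h.measurable_density.comp (measurable_pi_apply j)).aestronglyMeasurable
  have hL := aestronglyMeasurable_logForm h.measurable_frequency (r := r) (Measure.pi fun _ => μ)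
  have hdiff : Differentiable ℂ fun s => ∫ t : Fin r → T,
      (∏ j, φ (t j)) * exp (logForm (fun j => α (t j)) s) ∂Measure.pi fun _ => μ := by
    intro s
    obtain ⟨C, hC⟩ := exists_exp_sum_norm_log_prefixSum_le r h.pos
      (N := ‖s‖ + 1) (by positivity)
    refine differentiableAt_integral_mul_exp one_pos hφ hL
      (((integrable_prod_density h r).const_mul (Real.exp C)).mono' ?_ (ae_of_all _ fun t => ?_))
    · have hexp := continuous_exp.comp_aestronglyMeasurable
        ((ContinuousLinearMap.apply ℂ ℂ s).continuous.comp_aestronglyMeasurable hL)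
      exact (hφ.mul hexp).norm.mul
        (Real.continuous_exp.comp_aestronglyMeasurable (hL.norm.const_mul 1))
    · have hlog := (norm_exp_logForm_mul_exp_le (fun j => α (t j)) s zero_le_one).trans
        (hC _ fun j => h.le_re (t j))
      rw [Real.norm_of_nonneg (by positivity), norm_mul, mul_assoc, norm_prod,
        Finset.prod_mul_distrib, mul_left_comm (Real.exp C)]
      exact mul_le_mul_of_nonneg_left hlog (by positivity)
  rw [funext (multiZeta_eq_integral_exp_logForm h)]
  exact hdiff.comp differentiable_id.neg

theorem tendsto_multiZeta {ι : Type*} {l : Filter ι} [l.IsCountablyGenerated] [l.NeBot]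
    {αs φs : ι → T → ℂ} (hd : ∀ᶠ i in l, IsExpDensity μ κ (αs i) (φs i))
    (hα : ∀ t, Tendsto (fun i => αs i t) l (𝓝 (α t)))
    (hφ : ∀ t, Tendsto (fun i => φs i t) l (𝓝 (φ t))) {g : T → ℝ} (hg : Integrable g μ)
    (hbound : ∀ᶠ i in l, ∀ t, ‖φs i t‖ * Real.exp ‖αs i t‖ ≤ g t) (s : Fin r → ℂ) :
    Tendsto (fun i => multiZeta r μ (αs i) (φs i) s) l (𝓝 (multiZeta r μ α φ s)) := by
  obtain ⟨_, hi⟩ := hd.exists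
  have hre (t : T) : κ ≤ (α t).re :=
    ge_of_tendsto ((continuous_re.tendsto _).comp (hα t)) (hd.mono fun _ h => h.le_re t)
  obtain ⟨C, hC⟩ := exists_exp_sum_norm_log_prefixSum_le r hi.pos (norm_nonneg s)
  refine tendsto_integral_filter_of_dominated_convergence
    (fun t => Real.exp C * ∏ j, g (t j)) ?_ ?_
    ((Integrable.fintype_prod fun _ => hg).const_mul _) (ae_of_all _ fun t => ?_)
  · filter_upwards [hd] with i h
    refine Measurable.aestronglyMeasurable (Measurable.mul ?_ ?_)
    · exact Finset.measurable_fun_prod _ fun j _ =>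
        h.measurable_density.comp (measurable_pi_apply j)
    · exact Finset.measurable_fun_prod _ fun k _ =>
        (measurable_prefixSum h.measurable_frequency k).pow_const _
  · filter_upwards [hd, hbound] with i h hb
    refine ae_of_all _ fun t => ?_
    have hlog := (norm_exp_logForm_mul_exp_le (fun j => αs i (t j)) (-s) le_rfl).trans
      (by simpa using hC _ fun j => h.le_re (t j))
    rw [zero_mul, Real.exp_zero, mul_one] at hlog
    calc _ ≤ (∏ j, ‖φs i (t j)‖) * (Real.exp C * ∏ j, Real.exp ‖αs i (t j)‖) := by
          rw [prod_prefixSum_cpow_neg h.pos fun j => h.le_re (t j), norm_mul, norm_prod]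
          gcongr
      _ = Real.exp C * ∏ j, (‖φs i (t j)‖ * Real.exp ‖αs i (t j)‖) := by
          rw [Finset.prod_mul_distrib, mul_left_comm]
      _ ≤ _ := by
          gcongr with j
          exact hb (t j)
  · refine (tendsto_finsetProd _ fun j _ => hφ (t j)).mul (tendsto_finsetProd _ fun k _ => ?_)
    refine (tendsto_finsetSum _ fun j _ => hα (t j)).cpow tendsto_const_nhds (Or.inl ?_)
    exact hi.pos.trans_le (le_re_prefixSum hi.pos.le (fun j => hre (t j)) k)

end MultiZeta

section HankelRepresentation

variable {r : ℕ} {ε : ℝ}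

lemma SmallRadius.card_mul_lt_one (hε : SmallRadius r ε) (A : Finset (Fin r)) :
    (A.card : ℝ) * ε < 1 := by
  have hcard : (A.card : ℝ) ≤ r := by exact_mod_cast card_finset_fin_le A
  exact (mul_le_mul_of_nonneg_right hcard hε.1.le).trans_lt hε.2

lemma abs_im_sum_hankelPoint_lt_one (hε : SmallRadius r ε) (A : Finset (Fin r)) (u : Fin r → ℝ) :
    |(∑ k ∈ A, hankelPoint ε (u k)).im| < 1 := by
  rw [im_sum]
  calc |∑ k ∈ A, (hankelPoint ε (u k)).im| ≤ ∑ k ∈ A, |(hankelPoint ε (u k)).im| :=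
        Finset.abs_sum_le_sum_abs _ _
    _ ≤ A.card • ε := Finset.sum_le_card_nsmul _ _ _ fun k _ => abs_im_hankelPoint_le hε.1 _
    _ < 1 := by rw [nsmul_eq_mul]; exact hε.card_mul_lt_one A

lemma hankelFactor_mul_prod {s : Fin r → ℂ} (hs : NonInteger s) :
    hankelFactor r s * ∏ k, ((exp (2 * Real.pi * I * s k) - 1) * Gamma (s k)) = 1 := by
  rw [hankelFactor, ← Finset.prod_mul_distrib]
  refine Finset.prod_eq_one fun k _ => one_div_mul_cancel (mul_ne_zero ?_ ?_)
  · rw [sub_ne_zero]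
    intro h
    obtain ⟨n, hn⟩ := Complex.exp_eq_one_iff.mp h
    exact hs k n (mul_left_cancel₀ two_pi_I_ne_zero (by rw [hn, mul_comm]))
  · exact Gamma_ne_zero fun m hm => hs k (-m) (by rw [hm]; push_cast; rfl)

variable {T : Type*} [MeasurableSpace T] {μ : Measure T} {κ : ℝ} {α φ : T → ℂ}

/-- The superposition, over `t ∈ T ^ r`, of products of one-variable integrands which represents
the `r`-fold Hankel integrand of an exponential transform. -/
noncomputable def hankelSuperposition (α φ : T → ℂ) (ε : ℝ) (s : Fin r → ℂ) (u : Fin r → ℝ)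
    (t : Fin r → T) : ℂ :=
  (∏ j, φ (t j)) * ∏ k, (exp (-prefixSum (fun j => α (t j)) k * hankelPoint ε (u k)) *
    hankelWeight ε (s k) (u k))

lemma norm_hankelSuperposition_le (h : IsExpDensity μ κ α φ) (hε : SmallRadius r ε)
    (s : Fin r → ℂ) (u : Fin r → ℝ) (t : Fin r → T) :
    ‖hankelSuperposition α φ ε s u t‖ ≤
      Real.exp κ * ((∏ k, (Real.exp (-κ * hankelRadius ε (u k)) * ‖hankelWeight ε (s k) (u k)‖)) *
        ∏ j, (‖φ (t j)‖ * Real.exp ‖α (t j)‖)) := by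
  have hκ := h.pos
  have hε0 := hε.1
  set S := ∑ j, ‖α (t j)‖
  have hfactor (k : Fin r) :
      ‖exp (-prefixSum (fun j => α (t j)) k * hankelPoint ε (u k))‖ ≤
        Real.exp (-κ * hankelRadius ε (u k)) * Real.exp (ε * (S + κ)) :=
    (norm_exp_neg_mul_hankelPoint_le hε0 hκ.le (le_re_prefixSum hκ.le (fun j => h.le_re (t j)) k)
      (u k)).trans (by gcongr; exact norm_prefixSum_le _ k)
  have hconst : ∏ _k : Fin r, Real.exp (ε * (S + κ)) ≤ Real.exp κ * Real.exp S := by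
    rw [← Real.exp_sum, ← Real.exp_add, Real.exp_le_exp, Finset.sum_const, Finset.card_univ,
      Fintype.card_fin, nsmul_eq_mul, ← mul_assoc, add_comm κ]
    exact mul_le_of_le_one_left (add_nonneg (Finset.sum_nonneg fun _ _ => norm_nonneg _) hκ.le)
      hε.2.le
  calc ‖hankelSuperposition α φ ε s u t‖
      ≤ (∏ j, ‖φ (t j)‖) * ∏ k, (Real.exp (-κ * hankelRadius ε (u k)) * Real.exp (ε * (S + κ)) *
          ‖hankelWeight ε (s k) (u k)‖) := by
        rw [hankelSuperposition, norm_mul, norm_prod, norm_prod]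
        gcongr with k
        rw [norm_mul]
        gcongr
        exact hfactor k
    _ = (∏ _k : Fin r, Real.exp (ε * (S + κ))) * ((∏ j, ‖φ (t j)‖) *
          ∏ k, (Real.exp (-κ * hankelRadius ε (u k)) * ‖hankelWeight ε (s k) (u k)‖)) := by
        simp only [Finset.prod_mul_distrib]
        ring
    _ ≤ Real.exp κ * Real.exp S * ((∏ j, ‖φ (t j)‖) *
          ∏ k, (Real.exp (-κ * hankelRadius ε (u k)) * ‖hankelWeight ε (s k) (u k)‖)) := by
        gcongr
    _ = _ := by
        rw [Finset.prod_mul_distrib (f := fun j => ‖φ (t j)‖), ← Real.exp_sum]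
        ring

lemma integral_hankelSuperposition_left (h : IsExpDensity μ κ α φ) (hε : 0 < ε) {s : Fin r → ℂ}
    (hs : NonInteger s) (t : Fin r → T) :
    ∫ u, hankelSuperposition α φ ε s u t =
      (∏ k, ((exp (2 * Real.pi * I * s k) - 1) * Gamma (s k))) *
        ((∏ j, φ (t j)) * ∏ k, prefixSum (fun j => α (t j)) k ^ (-s k)) := by
  have hray (k : Fin r) :
      ∫ u, exp (-prefixSum (fun j => α (t j)) k * hankelPoint ε u) * hankelWeight ε (s k) u =
        (exp (2 * Real.pi * I * s k) - 1) * Gamma (s k) *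
          prefixSum (fun j => α (t j)) k ^ (-s k) := by
    rw [integral_exp_neg_mul_hankelWeight hε
      (h.pos.trans_le (le_re_prefixSum h.pos.le (fun j => h.le_re (t j)) k))
      fun n => by exact_mod_cast hs k (-n), ← mul_assoc]
  simp only [hankelSuperposition]
  rw [integral_const_mul, integral_fintype_prod_volume_eq_prod fun k u =>
    exp (-prefixSum (fun j => α (t j)) k * hankelPoint ε u) * hankelWeight ε (s k) u]
  simp only [hray, Finset.prod_mul_distrib]
  ring

variable [SigmaFinite μ]

lemma integrable_hankelSuperposition (h : IsExpDensity μ κ α φ) (hε : SmallRadius r ε)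
    (s : Fin r → ℂ) :
    Integrable (Function.uncurry (hankelSuperposition α φ ε s))
      (volume.prod (Measure.pi fun _ => μ)) := by
  have hcontour : Integrable fun u : Fin r → ℝ =>
      ∏ k, (Real.exp (-κ * hankelRadius ε (u k)) * ‖hankelWeight ε (s k) (u k)‖) :=
    Integrable.fintype_prod
      (f := fun k u => Real.exp (-κ * hankelRadius ε u) * ‖hankelWeight ε (s k) u‖)
      fun k => integrable_exp_neg_hankelRadius_mul_norm_hankelWeight hε.1 h.pos (s k)
  refine ((hcontour.mul_prod (integrable_prod_density h r)).const_mul (Real.exp κ)).mono' ?_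
    (ae_of_all _ fun z => norm_hankelSuperposition_le h hε s z.1 z.2)
  refine Measurable.aestronglyMeasurable (Measurable.mul ?_ ?_)
  · exact Finset.measurable_fun_prod _ fun j _ =>
      h.measurable_density.comp ((measurable_pi_apply j).comp measurable_snd)
  · refine Finset.measurable_fun_prod _ fun k _ => ?_
    have hsum : Measurable fun z : (Fin r → ℝ) × (Fin r → T) =>
        prefixSum (fun j => α (z.2 j)) k :=
      (measurable_prefixSum h.measurable_frequency k).comp measurable_snd
    exact ((hsum.neg.mul (by fun_prop)).cexp).mul (by fun_prop)

variable {K : ℂ → ℂ}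

lemma hankelIntegrand_eq_integral_hankelSuperposition
    (hK : ∀ y : ℂ, |y.im| < 1 → K y = expTransform μ α φ y) (hε : SmallRadius r ε)
    (s : Fin r → ℂ) (u : Fin r → ℝ) :
    hankelIntegrand r K ε s u =
      ∫ t, hankelSuperposition α φ ε s u t ∂Measure.pi fun _ => μ := by
  have hkernel (j : Fin r) : K (∑ k ∈ Finset.Ici j, hankelPoint ε (u k)) =
      ∫ t, φ t * exp (-α t * ∑ k ∈ Finset.Ici j, hankelPoint ε (u k)) ∂μ :=
    hK _ (abs_im_sum_hankelPoint_lt_one hε _ u)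
  have hdual (t : Fin r → T) :
      ∏ j, exp (-α (t j) * ∑ k ∈ Finset.Ici j, hankelPoint ε (u k)) =
        ∏ k, exp (-prefixSum (fun j => α (t j)) k * hankelPoint ε (u k)) := by
    simp only [← Complex.exp_sum, neg_mul, Finset.sum_neg_distrib,
      sum_mul_sum_Ici_eq_sum_prefixSum_mul]
  rw [hankelIntegrand]
  simp only [hkernel]
  rw [← integral_fintype_prod_eq_prod (μ := fun _ => μ) fun (j : Fin r) t =>
    φ t * exp (-α t * ∑ k ∈ Finset.Ici j, hankelPoint ε (u k)), ← integral_mul_const]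
  simp only [Finset.prod_mul_distrib, hdual, hankelSuperposition, hankelWeight, mul_assoc]

theorem integrable_hankelIntegrand_of_eq_expTransform (h : IsExpDensity μ κ α φ)
    (hK : ∀ y : ℂ, |y.im| < 1 → K y = expTransform μ α φ y) (hε : SmallRadius r ε)
    (s : Fin r → ℂ) : Integrable (hankelIntegrand r K ε s) :=
  (integrable_hankelSuperposition h hε s).integral_prod_left.congr
    (ae_of_all _ fun u => (hankelIntegrand_eq_integral_hankelSuperposition hK hε s u).symm)

/-- By Fubini, each frequency vector contributes a product of `r` Hankel integrals of gamma type,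
since `∑ⱼ αⱼ yⱼ = ∑ₖ (α₁ + ⋯ + α_k) xₖ`. -/
theorem hankelFactor_mul_hankelIntegral_eq_multiZeta (h : IsExpDensity μ κ α φ)
    (hK : ∀ y : ℂ, |y.im| < 1 → K y = expTransform μ α φ y) (hε : SmallRadius r ε)
    {s : Fin r → ℂ} (hs : NonInteger s) :
    hankelFactor r s * hankelIntegral r K ε s = multiZeta r μ α φ s := by
  have hswap : hankelIntegral r K ε s =
      (∏ k, ((exp (2 * Real.pi * I * s k) - 1) * Gamma (s k))) * multiZeta r μ α φ s := by
    rw [hankelIntegral, funext (hankelIntegrand_eq_integral_hankelSuperposition hK hε s),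
      integral_integral_swap (integrable_hankelSuperposition h hε s), multiZeta,
      ← integral_const_mul]
    simp only [integral_hankelSuperposition_left h hε.1 hs]
  rw [hswap, ← mul_assoc, hankelFactor_mul_prod hs, one_mul]

end HankelRepresentation

section LogisticDistribution

/-- The log-odds of `x`; for `x` uniform on the unit interval it has the logistic distribution. -/
noncomputable def logit (x : unitInterval) : ℝ :=
  Real.log x - Real.log (1 - x)

@[fun_prop]
lemma measurable_logit : Measurable logit := by
  unfold logit
  fun_prop

lemma logit_symm (x : unitInterval) : logit (unitInterval.symm x) = -logit x := by
  simp [logit]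

lemma integral_logit : ∫ x, logit x = 0 := by
  have h := unitInterval.measurePreserving_symm.integral_comp
    unitInterval.symmMeasurableEquiv.measurableEmbedding logit
  simp only [logit_symm, integral_neg] at h
  linarith

lemma exp_mul_logit_ae_eq (z : ℂ) :
    (fun x : unitInterval => exp (z * logit x)) =ᵐ[volume]
      fun x => (x : ℂ) ^ (1 + z - 1) * (1 - (x : ℂ)) ^ (1 - z - 1) := by
  filter_upwards [compl_mem_ae_iff.mpr (measure_singleton (0 : unitInterval)),
    compl_mem_ae_iff.mpr (measure_singleton (1 : unitInterval))] with x hx0 hx1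
  have hpos : 0 < (x : ℝ) := unitInterval.pos_iff_ne_zero.mpr hx0
  have hlt : 0 < 1 - (x : ℝ) := sub_pos.mpr (unitInterval.lt_one_iff_ne_one.mpr hx1)
  rw [← ofReal_one, ← ofReal_sub, cpow_def_of_ne_zero (ofReal_ne_zero.mpr hpos.ne'),
    cpow_def_of_ne_zero (ofReal_ne_zero.mpr hlt.ne'), ← ofReal_log hpos.le, ← ofReal_log hlt.le,
    ← Complex.exp_add, logit]
  push_cast
  ring_nf

lemma integrable_exp_mul_logit {z : ℂ} (hz : |z.re| < 1) :
    Integrable fun x : unitInterval => exp (z * logit x) := by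
  obtain ⟨hleft, hright⟩ := abs_lt.mp hz
  have hbeta := betaIntegral_convergent (u := 1 + z) (v := 1 - z)
    (by simp only [add_re, one_re]; linarith) (by simp only [sub_re, one_re]; linarith)
  rw [intervalIntegrable_iff_integrableOn_Icc_of_le zero_le_one] at hbeta
  exact (unitInterval.measurePreserving_coe.integrable_comp_of_integrable hbeta).congr
    (exp_mul_logit_ae_eq z).symm

lemma complexMGF_logit {z : ℂ} (hz : |z.re| < 1) :
    ProbabilityTheory.complexMGF logit volume z = Gamma (1 + z) * Gamma (1 - z) := by
  obtain ⟨hleft, hright⟩ := abs_lt.mp hz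
  rw [Gamma_mul_Gamma_eq_betaIntegral (by simp only [add_re, one_re]; linarith)
    (by simp only [sub_re, one_re]; linarith), show 1 + z + (1 - z) = 1 + 1 by ring,
    Gamma_add_one 1 one_ne_zero, Gamma_one, one_mul, one_mul, betaIntegral,
    intervalIntegral.integral_of_le zero_le_one, ← integral_Icc_eq_integral_Ioc,
    ← integral_subtype measurableSet_Icc]
  exact integral_congr_ae (exp_mul_logit_ae_eq z)

lemma Ioo_subset_integrableExpSet_logit :
    Ioo (-1) 1 ⊆ ProbabilityTheory.integrableExpSet logit volume := by
  intro a ha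
  have h := (integrable_exp_mul_logit (z := a) (abs_lt.mpr ha)).norm
  simpa [ProbabilityTheory.integrableExpSet, norm_exp] using h

lemma mem_interior_integrableExpSet_logit {a : ℝ} (ha : |a| < 1) :
    a ∈ interior (ProbabilityTheory.integrableExpSet logit volume) :=
  interior_maximal Ioo_subset_integrableExpSet_logit isOpen_Ioo (abs_lt.mp ha)

lemma integrable_exp_mul_abs_logit {a : ℝ} (ha : |a| < 1) :
    Integrable fun x => Real.exp (a * |logit x|) :=
  ProbabilityTheory.integrable_exp_mul_abs (Ioo_subset_integrableExpSet_logit (abs_lt.mp ha))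
    (Ioo_subset_integrableExpSet_logit (abs_lt.mp (by rwa [abs_neg])))

end LogisticDistribution

section BernoulliKernel

/-- The frequencies of the superposition `w / (e ^ w - 1) = ∫ e ^ (-frequency x * w) dx`. -/
noncomputable def frequency (x : unitInterval) : ℂ :=
  1 / 2 + (logit x / (2 * Real.pi) : ℝ) * I

/-- The derivative of `w / (e ^ w - 1)`, with the removable singularity at `w = 0` filled. -/
noncomputable def bernoulliKernel (w : ℂ) : ℂ :=
  if w = 0 then -1 / 2 else 1 / (exp w - 1) - w * exp w / (exp w - 1) ^ 2

@[fun_prop]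
lemma measurable_frequency : Measurable frequency := by
  unfold frequency
  fun_prop

lemma re_frequency (x : unitInterval) : (frequency x).re = 1 / 2 := by
  simp [frequency, -ofReal_div]

lemma norm_frequency_le (x : unitInterval) :
    ‖frequency x‖ ≤ 1 / 2 + |logit x| / (2 * Real.pi) := by
  refine (norm_add_le _ _).trans_eq ?_
  rw [norm_mul, norm_I, mul_one, norm_real, Real.norm_eq_abs, abs_div,
    abs_of_pos Real.two_pi_pos]
  norm_num

lemma integrable_exp_mul_norm_frequency {a : ℝ} (ha : 0 ≤ a) (ha' : a < 2 * Real.pi) :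
    Integrable fun x => Real.exp (a * ‖frequency x‖) := by
  have hdiv : |a / (2 * Real.pi)| < 1 := by
    rwa [abs_of_nonneg (by positivity), div_lt_one Real.two_pi_pos]
  refine ((integrable_exp_mul_abs_logit hdiv).const_mul (Real.exp (a / 2))).mono'
    (by fun_prop) (ae_of_all _ fun x => ?_)
  rw [Real.norm_of_nonneg (Real.exp_pos _).le, ← Real.exp_add]
  refine Real.exp_le_exp.mpr ((mul_le_mul_of_nonneg_left (norm_frequency_le x) ha).trans_eq ?_)
  ring

lemma exp_neg_frequency_mul (x : unitInterval) (w : ℂ) :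
    exp (-frequency x * w) = exp (-w / 2) * exp (-I * w / (2 * Real.pi) * logit x) := by
  rw [← Complex.exp_add, frequency]
  push_cast
  ring_nf

lemma abs_re_neg_I_mul_div_lt_one {w : ℂ} (hw : |w.im| < 2 * Real.pi) :
    |(-I * w / (2 * Real.pi)).re| < 1 := by
  have hre : (-I * w / (2 * Real.pi)).re = w.im / (2 * Real.pi) := by
    rw [← ofReal_ofNat, ← ofReal_mul, div_ofReal_re]
    simp
  rwa [hre, abs_div, abs_of_pos Real.two_pi_pos, div_lt_one Real.two_pi_pos]

lemma integral_exp_neg_frequency_mul (w : ℂ) :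
    ∫ x, exp (-frequency x * w) =
      exp (-w / 2) * ProbabilityTheory.complexMGF logit volume (-I * w / (2 * Real.pi)) := by
  simp only [exp_neg_frequency_mul, integral_const_mul, ProbabilityTheory.complexMGF]

lemma exp_ne_one_of_abs_im_lt {w : ℂ} (h0 : w ≠ 0) (hw : |w.im| < 2 * Real.pi) :
    exp w ≠ 1 := by
  intro h
  obtain ⟨n, rfl⟩ := exp_eq_one_iff.mp h
  have him : ((n : ℂ) * (2 * Real.pi * I)).im = n * (2 * Real.pi) := by simp
  rw [him, abs_mul, abs_of_pos Real.two_pi_pos, mul_lt_iff_lt_one_left Real.two_pi_pos,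
    ← Int.cast_abs] at hw
  simp [Int.abs_lt_one_iff.mp (by exact_mod_cast hw)] at h0

theorem integral_exp_neg_frequency_mul_eq_div {w : ℂ} (h0 : w ≠ 0) (hw : |w.im| < 2 * Real.pi) :
    ∫ x, exp (-frequency x * w) = w / (exp w - 1) := by
  have hπ : (Real.pi : ℂ) ≠ 0 := ofReal_ne_zero.mpr Real.pi_ne_zero
  have hz : -I * w / (2 * Real.pi) ≠ 0 := by simp [h0, hπ]
  have hsin : sin (Real.pi * (-I * w / (2 * Real.pi))) =
      (exp (-w / 2) - exp (w / 2)) * I / 2 := by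
    rw [Complex.sin]
    congr 4 <;> field_simp <;> simp
  have hhalf : exp (-w / 2) * (exp w - 1) = -(exp (-w / 2) - exp (w / 2)) := by
    rw [mul_sub, ← Complex.exp_add]
    ring_nf
  have hne : exp w - 1 ≠ 0 := sub_ne_zero.mpr (exp_ne_one_of_abs_im_lt h0 hw)
  have hne' : exp (-w / 2) - exp (w / 2) ≠ 0 :=
    neg_ne_zero.mp (hhalf ▸ mul_ne_zero (exp_ne_zero _) hne)
  rw [integral_exp_neg_frequency_mul, complexMGF_logit (abs_re_neg_I_mul_div_lt_one hw),
    add_comm, Gamma_add_one _ hz, mul_assoc, Gamma_mul_Gamma_one_sub, hsin, eq_div_iff hne]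
  calc _ = exp (-w / 2) * (exp w - 1) * -w / (exp (-w / 2) - exp (w / 2)) := by field_simp
    _ = w := by rw [hhalf, neg_mul_neg, mul_div_cancel_left₀ _ hne']

lemma hasDerivAt_integral_exp_neg_frequency_mul {w : ℂ} (hw : |w.im| < 2 * Real.pi) :
    HasDerivAt (fun w => ∫ x, exp (-frequency x * w))
      (∫ x, -frequency x * exp (-frequency x * w)) w := by
  have hmem := mem_interior_integrableExpSet_logit (abs_re_neg_I_mul_div_lt_one hw)
  have hint := ProbabilityTheory.integrable_cexp_mul_of_re_mem_interior_integrableExpSet hmem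
  have hint' := ProbabilityTheory.integrable_pow_mul_cexp_of_re_mem_interior_integrableExpSet hmem 1
  have hscale : HasDerivAt (fun w : ℂ => -I * w / (2 * Real.pi)) (-I / (2 * Real.pi)) w := by
    simpa using ((hasDerivAt_id w).const_mul (-I)).div_const (2 * Real.pi : ℂ)
  have hexp : HasDerivAt (fun w : ℂ => exp (-w / 2)) (exp (-w / 2) * (-1 / 2)) w :=
    ((hasDerivAt_id w).neg.div_const 2).cexp
  simp only [integral_exp_neg_frequency_mul]
  convert! hexp.mul ((ProbabilityTheory.hasDerivAt_complexMGF hmem).comp w hscale) using 1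
  simp only [pow_one] at hint'
  rw [Function.comp_apply, ProbabilityTheory.complexMGF, ← integral_const_mul, ← integral_mul_const,
    ← integral_const_mul, ← integral_add (hint.const_mul _) ((hint'.mul_const _).const_mul _)]
  refine integral_congr_ae (ae_of_all _ fun x => ?_)
  simp only [exp_neg_frequency_mul]
  simp only [frequency]
  push_cast
  ring

lemma integral_frequency : ∫ x, frequency x = 1 / 2 := by
  have hint : Integrable fun x => ((logit x / (2 * Real.pi) : ℝ) : ℂ) :=
    ((ProbabilityTheory.integrable_of_mem_interior_integrableExpSet
      (mem_interior_integrableExpSet_logit (by simp))).div_const _).ofReal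
  simp only [frequency]
  rw [integral_add (integrable_const (1 / 2 : ℂ)) (hint.mul_const I), integral_mul_const,
    integral_complex_ofReal]
  simp [integral_div, integral_logit]

theorem expTransform_frequency {w : ℂ} (hw : |w.im| < 2 * Real.pi) :
    expTransform volume frequency (fun x => -frequency x) w = bernoulliKernel w := by
  rw [expTransform, bernoulliKernel]
  split_ifs with h0
  · simp [h0, integral_neg, integral_frequency, neg_div]
  · have hne : exp w - 1 ≠ 0 := sub_ne_zero.mpr (exp_ne_one_of_abs_im_lt h0 hw)
    have hquot := (hasDerivAt_id w).div ((Complex.hasDerivAt_exp w).sub_const 1) hne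
    have hopen : IsOpen {w : ℂ | |w.im| < 2 * Real.pi} :=
      isOpen_lt (by fun_prop) continuous_const
    have heq : (fun w => ∫ x, exp (-frequency x * w)) =ᶠ[𝓝 w] fun w => w / (exp w - 1) := by
      filter_upwards [hopen.mem_nhds hw, isOpen_ne.mem_nhds h0] with w' hw' h0'
      exact integral_exp_neg_frequency_mul_eq_div h0' hw'
    rw [((hasDerivAt_integral_exp_neg_frequency_mul hw).congr_of_eventuallyEq heq.symm).unique
      hquot]
    simp only [id]
    field_simp

end BernoulliKernel

section Kernels

/-- The frequencies `λ * frequency x`, where `λ = c + v (1 - c)` runs through the segment from `c`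
to `1`; averaging over `v` turns the difference quotient of `w / (e ^ w - 1)` into an integral of
its derivative. -/
noncomputable def scaledFrequency (c : ℝ) (p : unitInterval × unitInterval) : ℂ :=
  (c + p.1 * (1 - c) : ℝ) * frequency p.2

/-- The density of the superposition that represents the argument shift `y ↦ y + a` of
`bernoulliKernel`. -/
noncomputable def shiftedDensity (a : ℝ) (p : unitInterval × unitInterval) : ℂ :=
  -frequency p.2 * exp (-frequency p.2 * a)

lemma add_mul_one_sub_mem_Icc {c : ℝ} (hc : c ∈ Icc (1 / 2 : ℝ) (3 / 2)) (v : unitInterval) :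
    c + v * (1 - c) ∈ Icc (1 / 2 : ℝ) (3 / 2) := by
  have h := (convex_Icc (1 / 2 : ℝ) (3 / 2)).add_smul_sub_mem hc (y := 1) (by norm_num) v.2
  simpa using h

lemma norm_shiftedDensity_le {a : ℝ} (ha : 0 ≤ a) (p : unitInterval × unitInterval) :
    ‖shiftedDensity a p‖ ≤ ‖frequency p.2‖ := by
  rw [shiftedDensity, norm_mul, norm_neg, norm_exp, re_mul_ofReal, neg_re, re_frequency]
  exact mul_le_of_le_one_right (norm_nonneg _) (Real.exp_le_one_iff.mpr (by linarith))

lemma norm_scaledFrequency_le {c : ℝ} (hc : c ∈ Icc (1 / 2 : ℝ) (3 / 2))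
    (p : unitInterval × unitInterval) :
    ‖scaledFrequency c p‖ ≤ 3 / 2 * ‖frequency p.2‖ := by
  obtain ⟨hlower, hupper⟩ := add_mul_one_sub_mem_Icc hc p.1
  rw [scaledFrequency, norm_mul, norm_real, Real.norm_of_nonneg (by linarith)]
  gcongr

lemma norm_shiftedDensity_mul_exp_le {c a : ℝ} (hc : c ∈ Icc (1 / 2 : ℝ) (3 / 2)) (ha : 0 ≤ a)
    (p : unitInterval × unitInterval) :
    ‖shiftedDensity a p‖ * Real.exp ‖scaledFrequency c p‖ ≤
      Real.exp (5 / 2 * ‖frequency p.2‖) :=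
  calc ‖shiftedDensity a p‖ * Real.exp ‖scaledFrequency c p‖
      ≤ Real.exp ‖frequency p.2‖ * Real.exp (3 / 2 * ‖frequency p.2‖) := by
        gcongr
        · linarith [norm_shiftedDensity_le ha p, Real.add_one_le_exp ‖frequency p.2‖]
        · exact norm_scaledFrequency_le hc p
    _ = _ := by rw [← Real.exp_add]; ring_nf

lemma integrable_exp_mul_norm_frequency_snd :
    Integrable fun p : unitInterval × unitInterval => Real.exp (5 / 2 * ‖frequency p.2‖) :=
  (integrable_exp_mul_norm_frequency (by norm_num)
    (by linarith [Real.pi_gt_three])).comp_snd volume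

@[fun_prop]
lemma measurable_scaledFrequency (c : ℝ) : Measurable (scaledFrequency c) := by
  unfold scaledFrequency
  fun_prop

@[fun_prop]
lemma measurable_shiftedDensity (a : ℝ) : Measurable (shiftedDensity a) := by
  unfold shiftedDensity
  fun_prop

lemma le_re_scaledFrequency {c : ℝ} (hc : c ∈ Icc (1 / 2 : ℝ) (3 / 2))
    (p : unitInterval × unitInterval) : 1 / 4 ≤ (scaledFrequency c p).re := by
  rw [scaledFrequency, re_ofReal_mul, re_frequency]
  linarith [(add_mul_one_sub_mem_Icc hc p.1).1]

lemma isExpDensity_shiftedDensity {c a : ℝ} (hc : c ∈ Icc (1 / 2 : ℝ) (3 / 2)) (ha : 0 ≤ a) :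
    IsExpDensity volume (1 / 4) (scaledFrequency c) (shiftedDensity a) where
  pos := by norm_num
  measurable_frequency := measurable_scaledFrequency c
  measurable_density := measurable_shiftedDensity a
  le_re := le_re_scaledFrequency hc
  integrable := integrable_exp_mul_norm_frequency_snd.mono' (by fun_prop) <|
    ae_of_all _ fun p => by
      rw [Real.norm_of_nonneg (by positivity)]
      exact norm_shiftedDensity_mul_exp_le hc ha p

lemma integrable_shiftedDensity_mul_exp {c a : ℝ} (hc : c ∈ Icc (1 / 2 : ℝ) (3 / 2)) (ha : 0 ≤ a)
    {y : ℂ} (hy : |y.im| < 1) :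
    Integrable fun p => shiftedDensity a p * exp (-scaledFrequency c p * y) := by
  refine (integrable_exp_mul_norm_frequency_snd.const_mul (Real.exp (3 / 4 * |y.re|))).mono'
    (by fun_prop) (ae_of_all _ fun p => ?_)
  obtain ⟨hlower, hupper⟩ := add_mul_one_sub_mem_Icc hc p.1
  have hre : -(scaledFrequency c p).re * y.re ≤ 3 / 4 * |y.re| := by
    rw [scaledFrequency, re_ofReal_mul, re_frequency]
    nlinarith [neg_abs_le y.re, abs_nonneg y.re]
  have him : (scaledFrequency c p).im * y.im ≤ ‖scaledFrequency c p‖ :=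
    calc (scaledFrequency c p).im * y.im
        ≤ |(scaledFrequency c p).im| * |y.im| := (le_abs_self _).trans_eq (abs_mul _ _)
      _ ≤ ‖scaledFrequency c p‖ * 1 := by gcongr; exact abs_im_le_norm _
      _ = _ := mul_one _
  have hexp : ‖exp (-scaledFrequency c p * y)‖ ≤
      Real.exp (3 / 4 * |y.re|) * Real.exp ‖scaledFrequency c p‖ := by
    rw [norm_exp, ← Real.exp_add, mul_re, neg_re, neg_im]
    gcongr
    linarith
  calc ‖shiftedDensity a p * exp (-scaledFrequency c p * y)‖
      ≤ ‖shiftedDensity a p‖ * (Real.exp (3 / 4 * |y.re|) * Real.exp ‖scaledFrequency c p‖) := by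
        rw [norm_mul]; gcongr
    _ = Real.exp (3 / 4 * |y.re|) *
          (‖shiftedDensity a p‖ * Real.exp ‖scaledFrequency c p‖) := by ring
    _ ≤ _ := by gcongr; exact norm_shiftedDensity_mul_exp_le hc ha p

lemma abs_im_mul_lt_two_pi {b : ℝ} (hb : b ∈ Icc (1 / 2 : ℝ) (3 / 2)) {y : ℂ} (hy : |y.im| < 1) :
    |(b * y).im| < 2 * Real.pi := by
  rw [im_ofReal_mul, abs_mul, abs_of_nonneg (by linarith [hb.1])]
  nlinarith [hb.1, hb.2, abs_nonneg y.im, Real.pi_gt_three]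

theorem expTransform_shiftedDensity {c a : ℝ} (hc : c ∈ Icc (1 / 2 : ℝ) (3 / 2)) (ha : 0 ≤ a)
    {y : ℂ} (hy : |y.im| < 1) :
    expTransform volume (scaledFrequency c) (shiftedDensity a) y =
      ∫ v : unitInterval, bernoulliKernel ((c + v * (1 - c) : ℝ) * y + a) := by
  rw [expTransform, Measure.volume_eq_prod,
    integral_prod _ (integrable_shiftedDensity_mul_exp hc ha hy)]
  refine integral_congr_ae (ae_of_all _ fun v => ?_)
  have him : |((c + v * (1 - c) : ℝ) * y + a).im| < 2 * Real.pi := by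
    rw [add_im, ofReal_im, add_zero]
    exact abs_im_mul_lt_two_pi (add_mul_one_sub_mem_Icc hc v) hy
  beta_reduce
  rw [← expTransform_frequency him, expTransform]
  refine integral_congr_ae (ae_of_all _ fun x => ?_)
  simp only [shiftedDensity, scaledFrequency, mul_assoc, ← Complex.exp_add]
  ring_nf

theorem hatKernel_eq_expTransform {t : ℝ} (h0 : 0 < t) (h1 : t ≤ 1) {y : ℂ} (hy : |y.im| < 1) :
    hatKernel t y =
      expTransform volume (scaledFrequency 1) (shiftedDensity (-Real.log t)) y := by
  have hexp : exp (y + (-Real.log t : ℝ)) = 1 / t * exp y := by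
    rw [Complex.exp_add, ← ofReal_exp, Real.exp_neg, Real.exp_log h0, ofReal_inv, one_div,
      mul_comm]
  have hzero : y + (-Real.log t : ℝ) = 0 ↔ y = Real.log t := by
    rw [ofReal_neg, ← sub_eq_add_neg, sub_eq_zero]
  rw [expTransform_shiftedDensity (by norm_num) (neg_nonneg.mpr (Real.log_nonpos h0.le h1)) hy]
  simp only [sub_self, mul_zero, add_zero, ofReal_one, one_mul, integral_const, probReal_univ,
    one_smul, hatKernel, bernoulliKernel, hzero, hexp]
  refine if_congr Iff.rfl rfl ?_
  push_cast
  ring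

lemma hasDerivAt_div_exp_sub_one {w : ℂ} (h0 : w ≠ 0) (hw : |w.im| < 2 * Real.pi) :
    HasDerivAt (fun w => w / (exp w - 1)) (bernoulliKernel w) w := by
  have hne : exp w - 1 ≠ 0 := sub_ne_zero.mpr (exp_ne_one_of_abs_im_lt h0 hw)
  convert! (hasDerivAt_id w).div ((Complex.hasDerivAt_exp w).sub_const 1) hne using 1
  rw [bernoulliKernel, if_neg h0]
  simp only [id]
  field_simp

lemma continuousAt_bernoulliKernel {w : ℂ} (h0 : w ≠ 0) (hw : |w.im| < 2 * Real.pi) :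
    ContinuousAt bernoulliKernel w := by
  have hne : exp w - 1 ≠ 0 := sub_ne_zero.mpr (exp_ne_one_of_abs_im_lt h0 hw)
  have hcont : ContinuousAt (fun w => 1 / (exp w - 1) - w * exp w / (exp w - 1) ^ 2) w := by
    fun_prop (disch := simp [hne])
  refine hcont.congr ?_
  filter_upwards [isOpen_ne.mem_nhds h0] with w' h0'
  rw [bernoulliKernel, if_neg h0']

lemma desKernel_eq_mul_integral_bernoulliKernel {c : ℝ} (hc : c ∈ Icc (1 / 2 : ℝ) (3 / 2)) {y : ℂ}
    (hy : |y.im| < 1) :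
    desKernel c y =
      (1 - c) * ∫ v : unitInterval, bernoulliKernel ((c + v * (1 - c) : ℝ) * y) := by
  by_cases h0 : y = 0
  · simp only [h0, desKernel, bernoulliKernel, mul_zero, if_true, integral_const,
      probReal_univ, one_smul]
    ring
  have hpath (v : ℝ) : (c * y + v • ((1 - c) * y) : ℂ) = (c + v * (1 - c) : ℝ) * y := by
    rw [real_smul]
    push_cast
    ring
  have hne (v : ℝ) (hv : v ∈ Icc (0 : ℝ) 1) : ((c + v * (1 - c) : ℝ) * y : ℂ) ≠ 0 := by
    refine mul_ne_zero (ofReal_ne_zero.mpr ?_) h0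
    linarith [(add_mul_one_sub_mem_Icc hc ⟨v, hv⟩).1]
  have him (v : ℝ) (hv : v ∈ Icc (0 : ℝ) 1) :=
    abs_im_mul_lt_two_pi (add_mul_one_sub_mem_Icc hc ⟨v, hv⟩) hy
  have hftc := intervalIntegral.integral_unitInterval_deriv_eq_sub
    (f := fun w => w / (exp w - 1)) (f' := bernoulliKernel) (z₀ := c * y) (z₁ := (1 - c) * y)
    (fun v hv => ContinuousAt.continuousWithinAt <|
      ContinuousAt.comp' (hpath v ▸ continuousAt_bernoulliKernel (hne v hv) (him v hv))
        (by fun_prop))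
    (fun v hv => hpath v ▸ hasDerivAt_div_exp_sub_one (hne v hv) (him v hv))
  simp only [hpath] at hftc
  rw [intervalIntegral.integral_of_le zero_le_one, ← integral_Icc_eq_integral_Ioc,
    ← integral_subtype measurableSet_Icc, show c * y + (1 - c) * y = y by ring, smul_eq_mul,
    mul_right_comm, ← eq_div_iff h0] at hftc
  rw [hftc, desKernel, if_neg h0]
  field_simp

theorem desKernel_eq_mul_expTransform {c : ℝ} (hc : c ∈ Icc (1 / 2 : ℝ) (3 / 2)) {y : ℂ}
    (hy : |y.im| < 1) :
    desKernel c y = (1 - c) * expTransform volume (scaledFrequency c) (shiftedDensity 0) y := by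
  rw [expTransform_shiftedDensity hc le_rfl hy, desKernel_eq_mul_integral_bernoulliKernel hc hy]
  simp

end Kernels

section DesingularizedZeta

variable {r : ℕ}

lemma hankelIntegrand_const_mul (r : ℕ) (b : ℂ) (K : ℂ → ℂ) (ε : ℝ) (s : Fin r → ℂ) :
    hankelIntegrand r (fun y => b * K y) ε s = fun u => b ^ r * hankelIntegrand r K ε s u := by
  ext u
  simp only [hankelIntegrand, Finset.prod_mul_distrib, Finset.prod_const, Finset.card_univ,
    Fintype.card_fin, mul_assoc]

lemma tendsto_multiZeta_shiftedDensity {ι : Type*} {l : Filter ι} [l.IsCountablyGenerated]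
    [l.NeBot] {c a : ι → ℝ} (hc : Tendsto c l (𝓝 1)) (ha : Tendsto a l (𝓝 0))
    (ha0 : ∀ᶠ i in l, 0 ≤ a i) (s : Fin r → ℂ) :
    Tendsto (fun i => multiZeta r volume (scaledFrequency (c i)) (shiftedDensity (a i)) s) l
      (𝓝 (multiZeta r volume (scaledFrequency 1) (shiftedDensity 0) s)) := by
  have hmem : ∀ᶠ i in l, c i ∈ Icc (1 / 2 : ℝ) (3 / 2) :=
    hc (Icc_mem_nhds (by norm_num) (by norm_num))
  refine tendsto_multiZeta (κ := 1 / 4) ?_ (fun p => ?_) (fun p => ?_)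
    integrable_exp_mul_norm_frequency_snd ?_ s
  · filter_upwards [hmem, ha0] with i hi hi0
    exact isExpDensity_shiftedDensity hi hi0
  · have hcont : Continuous fun c : ℝ => scaledFrequency c p := by
      unfold scaledFrequency
      fun_prop
    exact (hcont.tendsto 1).comp hc
  · have hcont : Continuous fun a : ℝ => shiftedDensity a p := by
      unfold shiftedDensity
      fun_prop
    exact (hcont.tendsto 0).comp ha
  · filter_upwards [hmem, ha0] with i hi hi0 p
    exact norm_shiftedDensity_mul_exp_le hi hi0 p

theorem isHatDesZeta_multiZeta {t : ℝ} (h0 : 0 < t) (h1 : t ≤ 1) :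
    IsHatDesZeta r t
      (multiZeta r volume (scaledFrequency 1) (shiftedDensity (-Real.log t))) := by
  have hd : IsExpDensity volume (1 / 4) (scaledFrequency 1) (shiftedDensity (-Real.log t)) :=
    isExpDensity_shiftedDensity (by norm_num) (neg_nonneg.mpr (Real.log_nonpos h0.le h1))
  have hK (y : ℂ) (hy : |y.im| < 1) := hatKernel_eq_expTransform h0 h1 hy
  exact ⟨differentiable_multiZeta hd, fun ε hε s hs =>
    ⟨integrable_hankelIntegrand_of_eq_expTransform hd hK hε s,
      (hankelFactor_mul_hankelIntegral_eq_multiZeta hd hK hε hs).symm⟩⟩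

theorem isDesZeta_multiZeta :
    IsDesZeta r (multiZeta r volume (scaledFrequency 1) (shiftedDensity 0)) := by
  refine ⟨differentiable_multiZeta (isExpDensity_shiftedDensity (by norm_num) le_rfl),
    fun ε hε s hs => ?_⟩
  have hnear : ∀ᶠ c in 𝓝[≠] (1 : ℝ), c ∈ Icc (1 / 2 : ℝ) (3 / 2) :=
    nhdsWithin_le_nhds (Icc_mem_nhds (by norm_num) (by norm_num))
  have hK {c : ℝ} (hc : c ∈ Icc (1 / 2 : ℝ) (3 / 2)) (hc1 : c ≠ 1) (y : ℂ) (hy : |y.im| < 1) :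
      (1 - c : ℂ)⁻¹ * desKernel c y =
        expTransform volume (scaledFrequency c) (shiftedDensity 0) y := by
    rw [desKernel_eq_mul_expTransform hc hy, inv_mul_cancel_left₀]
    exact sub_ne_zero.mpr (mod_cast hc1.symm)
  constructor
  · filter_upwards [hnear, self_mem_nhdsWithin] with c hc hc1
    have hint := integrable_hankelIntegrand_of_eq_expTransform
      (isExpDensity_shiftedDensity hc le_rfl) (hK hc hc1) hε s
    simp only [hankelIntegrand_const_mul] at hint
    refine (integrable_const_mul_iff (IsUnit.mk0 _ (pow_ne_zero r (inv_ne_zero ?_))) _).mp hint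
    exact sub_ne_zero.mpr (mod_cast Ne.symm hc1)
  · refine (tendsto_multiZeta_shiftedDensity (tendsto_id.mono_left nhdsWithin_le_nhds)
      tendsto_const_nhds (by simp) s).congr' ?_
    filter_upwards [hnear, self_mem_nhdsWithin] with c hc hc1
    rw [id, ← hankelFactor_mul_hankelIntegral_eq_multiZeta
      (isExpDensity_shiftedDensity hc le_rfl) (hK hc hc1) hε hs]
    simp only [hankelIntegral, hankelIntegrand_const_mul, integral_const_mul]
    ring

theorem tendsto_multiZeta_neg_log (s : Fin r → ℂ) :
    Tendsto (fun t => multiZeta r volume (scaledFrequency 1) (shiftedDensity (-Real.log t)) s)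
      (𝓝[<] 1) (𝓝 (multiZeta r volume (scaledFrequency 1) (shiftedDensity 0) s)) := by
  have hlog : Tendsto (fun t => -Real.log t) (𝓝[<] 1) (𝓝 0) := by
    simpa using (Real.continuousAt_log one_ne_zero).fun_neg.tendsto.mono_left nhdsWithin_le_nhds
  refine tendsto_multiZeta_shiftedDensity tendsto_const_nhds hlog ?_ s
  filter_upwards [Ioo_mem_nhdsLT (zero_lt_one (α := ℝ))] with t ht
  exact neg_nonneg.mpr (Real.log_nonpos ht.1.le ht.2.le)

end DesingularizedZeta

end DesMZF

theorem mainTheorem5 (r : ℕ) (hr : 1 ≤ r) :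
    ∃ (hatZeta : ℝ → (Fin r → ℂ) → ℂ) (desZeta : (Fin r → ℂ) → ℂ),
      (∀ t : ℝ, 0 < t → t < 1 → DesMZF.IsHatDesZeta r t (hatZeta t)) ∧
      DesMZF.IsDesZeta r desZeta ∧
      ∀ s : Fin r → ℂ,
        Filter.Tendsto (fun t : ℝ => hatZeta t s)
          (nhdsWithin (1 : ℝ) (Set.Iio 1)) (nhds (desZeta s)) :=
  ⟨fun t => DesMZF.multiZeta r MeasureTheory.volume (DesMZF.scaledFrequency 1)
      (DesMZF.shiftedDensity (-Real.log t)),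
    DesMZF.multiZeta r MeasureTheory.volume (DesMZF.scaledFrequency 1) (DesMZF.shiftedDensity 0),
    fun _ h0 h1 => DesMZF.isHatDesZeta_multiZeta h0 h1.le,
    DesMZF.isDesZeta_multiZeta,
    DesMZF.tendsto_multiZeta_neg_log⟩
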